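/- For integers $l,m,k$ with $k>0$ and $|l|\ge m>0$ let $$G(l,m;k)=\langle a,t\;;\; t^{-1}a^{-k}t\,a^{l}\,t^{-1}a^{k}t=a^{m}\rangle .$$ A group $H$ is a homomorphic image of a group $G$ if there is a surjective homomorphism $G\to H$. (i) The one-relator groups $G(18,2;2)$ and $G(18,2;6)$ are homomorphic images of each other, but they are not isomorphic. (ii) Consequently the answer to question 3.33 of the Kourovka Notebook is negative: two groups, each of which can be defined by a single relation and is a homomorphic image of the other, need not be isomorphic. (iii) The example is minimal in the following sense. Let $k_i>0$ and $|l_i|\ge m_i>0$ for $i=1,2$, and suppose that $G(l_1,m_1;k_1)$ and $G(l_2,m_2;k_2)$ are homomorphic images of each other and are not isomorphic. Then $m_1,m_2\ge 2$; for $i=1,2$, if $m_i=2$ then $|l_i|\ge 18$; and $\min(k_1,k_2)\ge 2$, $\max(k_1,k_2)\ge 6$. -/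

import Mathlib

/-- The word `t⁻¹ a⁻ᵏ t aˡ t⁻¹ aᵏ t a⁻ᵐ` in the free group on the two letters
`a = FreeGroup.of 0` and `t = FreeGroup.of 1`. -/
def brunnerRelator (l m k : ℤ) : FreeGroup (Fin 2) :=
  let a : FreeGroup (Fin 2) := FreeGroup.of 0
  let t : FreeGroup (Fin 2) := FreeGroup.of 1
  t⁻¹ * a ^ (-k) * t * a ^ l * t⁻¹ * a ^ k * t * (a ^ m)⁻¹

/-- The one-relator group `G(l,m;k) = ⟨a, t ; t⁻¹ a⁻ᵏ t aˡ t⁻¹ aᵏ t = aᵐ⟩`. -/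
abbrev BrunnerGroup (l m k : ℤ) : Type :=
  PresentedGroup {brunnerRelator l m k}

/-- `H` is a homomorphic image of `G`: there is a surjective homomorphism from `G` onto `H`. -/
def IsHomomorphicImage (H G : Type) [Group H] [Group G] : Prop :=
  ∃ f : G →* H, Function.Surjective f

/-- `G` has a presentation with a single defining relation `r = 1`. -/
def IsOneRelatorGroup (G : Type) [Group G] : Prop :=
  ∃ (α : Type) (r : FreeGroup α), Nonempty (G ≃* PresentedGroup {r})

/-- `G` and `H` are homomorphic images of each other and are not isomorphic. -/
def MutualImagesNotIsomorphic (G H : Type) [Group G] [Group H] : Prop :=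
  IsHomomorphicImage G H ∧ IsHomomorphicImage H G ∧ ¬ Nonempty (G ≃* H)

/-- The normalization of the parameters of `G(l,m;k)`: `k > 0` and `|l| ≥ m > 0`. -/
def IsAdmissible (l m k : ℤ) : Prop :=
  0 < k ∧ 0 < m ∧ m ≤ |l|

namespace HNNExtension

section Length

variable {G : Type*} [Group G] {A B : Subgroup G} {φ : A ≃* B}

/-- The number of stable letters in a reduced word representing `g`. -/
noncomputable def tlen (g : HNNExtension G A B φ) : ℕ :=
  (NormalWord.equiv φ (Classical.choice (NormalWord.TransversalPair.nonempty G A B))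
    g).toList.length

theorem exists_reducedWord (g : HNNExtension G A B φ) :
    ∃ w : NormalWord.ReducedWord G A B, w.prod φ = g ∧ w.toList.length = tlen g :=
  ⟨_, (NormalWord.equiv φ _).symm_apply_apply g, rfl⟩

theorem tlen_prod (w : NormalWord.ReducedWord G A B) : tlen (w.prod φ) = w.toList.length := by
  obtain ⟨w', h, h'⟩ := exists_reducedWord (w.prod φ)
  have := congrArg List.length (ReducedWord.map_fst_eq_and_of_prod_eq φ h).1
  simp only [List.length_map] at this
  omega

theorem tlen_of (h : G) : tlen (of h : HNNExtension G A B φ) = 0 := by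
  have := tlen_prod (φ := φ) { NormalWord.ReducedWord.empty G A B with head := h }
  simpa [NormalWord.ReducedWord.prod] using this

theorem tlen_one : tlen (1 : HNNExtension G A B φ) = 0 := by
  simpa using tlen_of (φ := φ) (1 : G)

theorem tlen_of_mul (h : G) (g : HNNExtension G A B φ) : tlen (of h * g) = tlen g := by
  obtain ⟨w, rfl, hw⟩ := exists_reducedWord g
  rw [← hw]
  have := tlen_prod (φ := φ) ⟨h * w.head, w.toList, w.chain⟩
  simpa [NormalWord.ReducedWord.prod, mul_assoc] using this

theorem tlen_eq_zero {g : HNNExtension G A B φ} : tlen g = 0 ↔ ∃ h, of h = g := by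
  constructor
  · intro hg
    obtain ⟨w, rfl, hw⟩ := exists_reducedWord g
    rw [hg, List.length_eq_zero_iff] at hw
    exact ⟨w.head, by simp [NormalWord.ReducedWord.prod, hw]⟩
  · rintro ⟨h, rfl⟩
    exact tlen_of h

/-- Stable letters move past elements of the associated subgroups. -/
theorem exists_t_zpow_mul_of (e : ℤˣ) {h : G} (hh : h ∈ toSubgroup A B e) :
    ∃ h' ∈ toSubgroup A B (-e),
      (t ^ (e : ℤ) * of h : HNNExtension G A B φ) = of h' * t ^ (e : ℤ) := by
  rcases Int.units_eq_one_or e with rfl | rfl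
  · exact ⟨φ ⟨h, hh⟩, (φ ⟨h, hh⟩).2, by simpa using t_mul_of (φ := φ) ⟨h, hh⟩⟩
  · refine ⟨φ.symm ⟨h, hh⟩, ?_, by simpa using inv_t_mul_of (φ := φ) ⟨h, hh⟩⟩
    simp

/-- An element of positive length starts with a stable letter, up to the base group; the length
grows by two when a letter that does not cancel is put in front. -/
theorem exists_head_of_tlen {g : HNNExtension G A B φ} (hg : tlen g ≠ 0) :
    ∃ (h : G) (e : ℤˣ) (g' : HNNExtension G A B φ), g = of h * (t ^ (e : ℤ) * g') ∧
      tlen g = tlen g' + 1 := by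
  obtain ⟨⟨h, l, hl⟩, rfl, hw⟩ := exists_reducedWord g
  cases l with
  | nil => simp at hw; omega
  | cons a l =>
    refine ⟨h, a.1, of a.2 * (l.map (fun x => t ^ (x.1 : ℤ) * of x.2)).prod, ?_, ?_⟩
    · simp [NormalWord.ReducedWord.prod, mul_assoc]
    · have := tlen_prod (φ := φ) ⟨a.2, l, (List.isChain_cons.1 hl).2⟩
      simp only [NormalWord.ReducedWord.prod] at this
      rw [this, ← hw]
      simp

theorem tlen_t_mul_or (e : ℤˣ) (g : HNNExtension G A B φ) :
    tlen (t ^ (e : ℤ) * g) = tlen g + 1 ∨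
    ∃ h ∈ toSubgroup A B e, ∃ g', g = of h * (t ^ ((-e : ℤˣ) : ℤ) * g') ∧ tlen g = tlen g' + 1 ∧
      tlen (t ^ (e : ℤ) * g) = tlen g' := by
  obtain ⟨⟨h, l, hl⟩, rfl, hw⟩ := exists_reducedWord g
  by_cases hc : ∀ a ∈ l.head?, h ∈ toSubgroup A B e → e = a.1
  · left
    have := tlen_prod (φ := φ) ⟨1, (e, h) :: l, List.isChain_cons.2 ⟨hc, hl⟩⟩
    simp only [NormalWord.ReducedWord.prod] at this ⊢
    simp only [NormalWord.ReducedWord.prod] at hw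
    rw [← hw]
    simpa [mul_assoc] using this
  · right
    push Not at hc
    obtain ⟨a, ha, hh, hea⟩ := hc
    cases l with
    | nil => simp at ha
    | cons a' l =>
      simp only [List.head?_cons, Option.mem_def, Option.some.injEq] at ha
      subst ha
      have hae : a'.1 = -e := by
        rcases Int.units_eq_one_or e with h1 | h1 <;>
          rcases Int.units_eq_one_or a'.1 with h2 | h2 <;> simp_all
      have h3 := tlen_prod (φ := φ) ⟨a'.2, l, (List.isChain_cons.1 hl).2⟩
      refine ⟨h, hh, of a'.2 * (l.map (fun x => t ^ (x.1 : ℤ) * of x.2)).prod, ?_, ?_, ?_⟩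
      · simp [NormalWord.ReducedWord.prod, mul_assoc, hae]
      · simp only [NormalWord.ReducedWord.prod] at h3
        rw [h3, ← hw]
        simp
      · obtain ⟨h', -, hh'⟩ := exists_t_zpow_mul_of (φ := φ) e hh
        simp only [NormalWord.ReducedWord.prod, List.map_cons, List.prod_cons]
        rw [← mul_assoc, hh', mul_assoc, tlen_of_mul, hae]
        simp [mul_assoc]

theorem tlen_t_mul_le (e : ℤˣ) (g : HNNExtension G A B φ) :
    tlen (t ^ (e : ℤ) * g) ≤ tlen g + 1 := by
  rcases tlen_t_mul_or e g with h | ⟨_, _, _, _, _, _⟩ <;> omega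

theorem tlen_t_mul_ne (e : ℤˣ) (g : HNNExtension G A B φ) :
    tlen (t ^ (e : ℤ) * g) ≠ tlen g := by
  rcases tlen_t_mul_or e g with h | ⟨_, _, _, _, _, _⟩ <;> omega

/-- Two consecutive stable letters either cancel or both contribute to the length. -/
theorem tlen_t_mul_of_t_mul {e : ℤˣ} {g : HNNExtension G A B φ}
    (hg : tlen (t ^ (e : ℤ) * g) = tlen g + 1) (e' : ℤˣ) {h : G}
    (hh : ¬ (h ∈ toSubgroup A B e' ∧ e' = -e)) :
    tlen (t ^ (e' : ℤ) * (of h * (t ^ (e : ℤ) * g))) = tlen g + 2 := by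
  obtain ⟨⟨x, l, hl⟩, rfl, hw⟩ := exists_reducedWord g
  have h1 : ∀ a ∈ l.head?, x ∈ toSubgroup A B e → e = a.1 := by
    by_contra hc
    push Not at hc
    obtain ⟨a, ha, hx, hea⟩ := hc
    cases l with
    | nil => simp at ha
    | cons a' l =>
      simp only [List.head?_cons, Option.mem_def, Option.some.injEq] at ha
      subst ha
      have hae : a'.1 = -e := by
        rcases Int.units_eq_one_or e with h1 | h1 <;>
          rcases Int.units_eq_one_or a'.1 with h2 | h2 <;> simp_all
      have h3 := tlen_prod (φ := φ) ⟨a'.2, l, (List.isChain_cons.1 hl).2⟩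
      obtain ⟨h', -, hh'⟩ := exists_t_zpow_mul_of (φ := φ) e hx
      rw [← hw] at hg
      simp only [NormalWord.ReducedWord.prod, List.map_cons, List.prod_cons] at hg h3
      rw [← mul_assoc, hh', mul_assoc, tlen_of_mul, hae] at hg
      simp only [Units.val_neg, zpow_neg, mul_assoc, mul_inv_cancel_left, h3] at hg
      simp only [List.length_cons] at hg
      omega
  have h2 : h ∈ toSubgroup A B e' → e' = e := by
    intro hm
    by_contra hne
    refine hh ⟨hm, ?_⟩
    rcases Int.units_eq_one_or e with h1 | h1 <;>
          rcases Int.units_eq_one_or e' with h2 | h2 <;> simp_all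
  have := tlen_prod (φ := φ) ⟨1, (e', h) :: (e, x) :: l, by
    refine List.isChain_cons.2 ⟨?_, List.isChain_cons.2 ⟨h1, hl⟩⟩
    simpa using h2⟩
  rw [← hw]
  simpa [mul_assoc, NormalWord.ReducedWord.prod] using this

theorem tlen_mul_le (x y : HNNExtension G A B φ) : tlen (x * y) ≤ tlen x + tlen y := by
  induction hn : tlen x generalizing x with
  | zero =>
    obtain ⟨h, rfl⟩ := tlen_eq_zero.1 hn
    simp [tlen_of_mul]
  | succ n ih =>
    obtain ⟨h, e, x', rfl, hx⟩ := exists_head_of_tlen (g := x) (by omega)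
    have := ih x' (by omega)
    have := tlen_t_mul_le e (x' * y)
    rw [mul_assoc, mul_assoc, tlen_of_mul]
    omega

theorem tlen_mul_of (g : HNNExtension G A B φ) (h : G) : tlen (g * of h) = tlen g := by
  have h1 := tlen_mul_le g (of h)
  have h2 := tlen_mul_le (g * of h) (of h⁻¹)
  rw [tlen_of] at h1 h2
  simp only [map_inv, mul_inv_cancel_right] at h2
  omega

theorem tlen_t_zpow_le (e : ℤˣ) : tlen (t ^ (e : ℤ) : HNNExtension G A B φ) ≤ 1 := by
  have := tlen_t_mul_le e (1 : HNNExtension G A B φ)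
  rwa [mul_one, tlen_one] at this

theorem tlen_t_zpow (e : ℤˣ) : tlen (t ^ (e : ℤ) : HNNExtension G A B φ) = 1 := by
  have := tlen_t_mul_ne e (1 : HNNExtension G A B φ)
  rw [mul_one, tlen_one] at this
  have := tlen_t_zpow_le (φ := φ) e
  omega

theorem tlen_inv_le (g : HNNExtension G A B φ) : tlen g⁻¹ ≤ tlen g := by
  induction hn : tlen g generalizing g with
  | zero =>
    obtain ⟨h, rfl⟩ := tlen_eq_zero.1 hn
    simp [← map_inv, tlen_of]
  | succ n ih =>
    obtain ⟨h, e, x', rfl, hx⟩ := exists_head_of_tlen (g := g) (by omega)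
    have := ih x' (by omega)
    have h2 := tlen_mul_le x'⁻¹ (t ^ ((-e : ℤˣ) : ℤ))
    have h3 := tlen_t_zpow (φ := φ) (-e)
    rw [mul_inv_rev, mul_inv_rev, ← map_inv, tlen_mul_of, ← zpow_neg, ← Units.val_neg]
    omega

theorem tlen_inv (g : HNNExtension G A B φ) : tlen g⁻¹ = tlen g :=
  le_antisymm (tlen_inv_le g) (by simpa using tlen_inv_le g⁻¹)

theorem exists_last_of_tlen {g : HNNExtension G A B φ} (hg : tlen g ≠ 0) :
    ∃ (h : G) (e : ℤˣ) (g' : HNNExtension G A B φ), g = g' * t ^ (e : ℤ) * of h ∧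
      tlen g = tlen g' + 1 := by
  obtain ⟨h, e, g', h1, h2⟩ := exists_head_of_tlen (g := g⁻¹) (by rwa [tlen_inv])
  refine ⟨h⁻¹, -e, g'⁻¹, ?_, by rw [tlen_inv] at h2; rwa [tlen_inv]⟩
  rw [← inv_inv g, h1]
  simp [mul_assoc]

theorem tlen_mul_t_le (g : HNNExtension G A B φ) (e : ℤˣ) :
    tlen (g * t ^ (e : ℤ)) ≤ tlen g + 1 := by
  have := tlen_mul_le g (t ^ (e : ℤ))
  rwa [tlen_t_zpow] at this

theorem tlen_mul_t_ne (g : HNNExtension G A B φ) (e : ℤˣ) :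
    tlen (g * t ^ (e : ℤ)) ≠ tlen g := by
  have := tlen_t_mul_ne (-e) g⁻¹
  rw [tlen_inv, ← tlen_inv] at this
  simpa using this

/-- The length is additive when the stable letter in the middle cancels on neither side. -/
theorem tlen_mul_t_mul {x y : HNNExtension G A B φ} {e : ℤˣ}
    (hx : tlen (x * t ^ (e : ℤ)) = tlen x + 1) (hy : tlen (t ^ (e : ℤ) * y) = tlen y + 1) :
    tlen (x * (t ^ (e : ℤ) * y)) = tlen x + 1 + tlen y := by
  induction hn : tlen x generalizing x y e with
  | zero =>
    obtain ⟨h, rfl⟩ := tlen_eq_zero.1 hn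
    rw [tlen_of_mul]
    omega
  | succ n ih =>
    obtain ⟨h, f, x', rfl, hx'⟩ := exists_last_of_tlen (g := x) (by omega)
    rw [tlen_mul_of] at hx'
    have hnp : ¬ (h ∈ toSubgroup A B f ∧ f = -e) := by
      rintro ⟨hm, rfl⟩
      obtain ⟨h', -, hh'⟩ := exists_t_zpow_mul_of (φ := φ) (-e) hm
      have : x' * t ^ ((-e : ℤˣ) : ℤ) * of h * t ^ (e : ℤ) = x' * of h' := by
        rw [mul_assoc x', hh']
        simp [mul_assoc]
      rw [this, tlen_mul_of] at hx
      rw [tlen_mul_of] at hx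
      omega
    have h1 := tlen_t_mul_of_t_mul hy f hnp
    have h2 := ih (x := x') (y := of h * (t ^ (e : ℤ) * y)) (e := f)
      hx' (by rw [tlen_of_mul]; omega) (by rw [tlen_mul_of] at hn; omega)
    rw [tlen_of_mul] at h2
    simp only [mul_assoc] at h2 ⊢
    rw [h2]
    omega

/-- If a conjugate of `h` by an element outside the base group lies in the base group, then
there is a pinch at the beginning. -/
theorem exists_pinch_of_conj {g : HNNExtension G A B φ} (hg : tlen g ≠ 0) {h y : G}
    (hc : of h * g = g * of y) :
    ∃ (x : G) (e : ℤˣ) (g' : HNNExtension G A B φ), g = of x * (t ^ (e : ℤ) * g') ∧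
      tlen g = tlen g' + 1 ∧ x⁻¹ * h * x ∈ toSubgroup A B (-e) ∧
      ∃ z ∈ toSubgroup A B e, (of (x⁻¹ * h * x) * t ^ (e : ℤ) : HNNExtension G A B φ) =
        t ^ (e : ℤ) * of z ∧ of z * g' = g' * of y := by
  obtain ⟨x, e, g', rfl, hl⟩ := exists_head_of_tlen hg
  rw [tlen_of_mul] at hl
  have key : of (x⁻¹ * h * x) * (t ^ (e : ℤ) * g') = t ^ (e : ℤ) * g' * of y := by
    simp only [map_mul, map_inv]
    have := congrArg (fun z => (of x)⁻¹ * z) hc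
    simpa [mul_assoc] using this
  have hm : x⁻¹ * h * x ∈ toSubgroup A B (-e) := by
    by_contra hm
    have := tlen_t_mul_of_t_mul hl (-e) (h := x⁻¹ * h * x) (by tauto)
    rw [key] at this
    simp only [Units.val_neg, zpow_neg, mul_assoc, inv_mul_cancel_left] at this
    rw [tlen_mul_of] at this
    omega
  obtain ⟨z, hz, hz'⟩ := exists_t_zpow_mul_of (φ := φ) (-e) hm
  rw [neg_neg] at hz
  have hz2 : (of (x⁻¹ * h * x) * t ^ (e : ℤ) : HNNExtension G A B φ) = t ^ (e : ℤ) * of z := by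
    have := congrArg (fun w => t ^ (e : ℤ) * w * t ^ (e : ℤ)) hz'
    simpa [mul_assoc] using this
  refine ⟨x, e, g', rfl, by rw [tlen_of_mul, hl], hm, z, hz, hz2, ?_⟩
  rw [← mul_assoc, hz2] at key
  simpa [mul_assoc] using key

end Length

end HNNExtension

namespace HNNExtension

theorem _root_.exists_forall_apply_le {α : Type*} [Nonempty α] (f : α → ℕ) :
    ∃ x, ∀ y, f x ≤ f y := by
  classical
  obtain ⟨x, hx⟩ := Nat.find_spec (⟨_, Classical.arbitrary α, rfl⟩ : ∃ n x, f x = n)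
  exact ⟨x, fun y => hx ▸ Nat.find_min' _ ⟨y, rfl⟩⟩

section Dynamics

variable {G : Type*} [Group G] {A B : Subgroup G} {φ : A ≃* B}

theorem tlen_pow_of_cyclicallyReduced {g : HNNExtension G A B φ} {e : ℤˣ}
    (hg : tlen (t ^ (e : ℤ) * g) = tlen g + 1)
    (hc : tlen (t ^ (e : ℤ) * g * t ^ (e : ℤ)) = tlen g + 2) (n : ℕ) :
    tlen ((t ^ (e : ℤ) * g) ^ n) = n * (tlen g + 1) ∧
      tlen ((t ^ (e : ℤ) * g) ^ n * t ^ (e : ℤ)) = n * (tlen g + 1) + 1 := by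
  induction n with
  | zero => simp [tlen_one, tlen_t_zpow]
  | succ n ih =>
    have hx : tlen ((t ^ (e : ℤ) * g) ^ n * t ^ (e : ℤ)) =
        tlen ((t ^ (e : ℤ) * g) ^ n) + 1 := by omega
    have h1 := tlen_mul_t_mul hx hg
    have h3 : tlen (g * t ^ (e : ℤ)) = tlen g + 1 := by
      have h4 := tlen_t_mul_le e (g * t ^ (e : ℤ))
      have h5 := tlen_mul_t_le g e
      rw [← mul_assoc] at h4
      omega
    have h2 := tlen_mul_t_mul hx (y := g * t ^ (e : ℤ)) (by rw [← mul_assoc]; omega)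
    constructor
    · rw [pow_succ, h1, ih.1]; ring
    · rw [pow_succ, mul_assoc, mul_assoc, h2, ih.1, h3]; ring

theorem tlen_t_mul_mul_t_of_min {g : HNNExtension G A B φ} {e : ℤˣ}
    (hg : tlen (t ^ (e : ℤ) * g) = tlen g + 1) (hmin : tlen g + 1 ≤ tlen (g * t ^ (e : ℤ))) :
    tlen (t ^ (e : ℤ) * g * t ^ (e : ℤ)) = tlen g + 2 := by
  by_cases h0 : tlen g = 0
  · obtain ⟨h, rfl⟩ := tlen_eq_zero.1 h0
    have := tlen_t_mul_of_t_mul (φ := φ) (e := e) (g := 1)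
      (by rw [mul_one, tlen_t_zpow, tlen_one]) e (h := h) (fun hh => by
        rcases Int.units_eq_one_or e with h1 | h1 <;> simp [h1] at hh)
    rw [h0]
    simpa [mul_assoc, tlen_one] using this
  · obtain ⟨h, f, p, hp, hl⟩ := exists_last_of_tlen h0
    have h1 : tlen (t ^ (e : ℤ) * p) ≤ tlen p + 1 := tlen_t_mul_le e p
    have h2 : tlen (t ^ (e : ℤ) * p * t ^ (f : ℤ)) = tlen g + 1 := by
      rw [← hg, hp, mul_assoc, ← tlen_mul_of _ h]
      simp [mul_assoc]
    have h3 := tlen_mul_t_le (t ^ (e : ℤ) * p) f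
    have h4 : tlen (g * t ^ (e : ℤ)) ≤ tlen p +
        tlen (t ^ (f : ℤ) * (of h * t ^ (e : ℤ)) : HNNExtension G A B φ) := by
      have := tlen_mul_le p (t ^ (f : ℤ) * (of h * t ^ (e : ℤ)))
      rw [hp]
      simpa [mul_assoc] using this
    have h5 := tlen_t_mul_le (φ := φ) f (of h * t ^ (e : ℤ))
    have h6 : tlen (of h * t ^ (e : ℤ) : HNNExtension G A B φ) = 1 := by
      rw [tlen_of_mul, tlen_t_zpow]
    have h7 := tlen_mul_t_mul (x := t ^ (e : ℤ) * p) (e := f) (y := of h * t ^ (e : ℤ))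
      (by omega) (by omega)
    have h8 : t ^ (e : ℤ) * g * t ^ (e : ℤ) =
        t ^ (e : ℤ) * p * (t ^ (f : ℤ) * (of h * t ^ (e : ℤ))) := by
      rw [hp]; simp [mul_assoc]
    rw [h8, h7]
    omega

/-- Every element is conjugate into the base group or to an element all whose powers have the
expected length. -/
theorem exists_conj_of_or_tlen_pow (g : HNNExtension G A B φ) :
    (∃ x h, g * x = x * of h) ∨
      ∃ x g', g * x = x * g' ∧ tlen g' ≠ 0 ∧ ∀ n : ℕ, tlen (g' ^ n) = n * tlen g' := by
  obtain ⟨x, hx⟩ : ∃ x, ∀ y, tlen (x⁻¹ * g * x) ≤ tlen (y⁻¹ * g * y) :=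
    exists_forall_apply_le fun x => tlen (x⁻¹ * g * x)
  by_cases h0 : tlen (x⁻¹ * g * x) = 0
  · obtain ⟨h, hh⟩ := tlen_eq_zero.1 h0
    exact Or.inl ⟨x, h, by rw [hh]; group⟩
  · right
    obtain ⟨h, e, g', h1, h2⟩ := exists_head_of_tlen h0
    have h3 : tlen (g' * of h) = tlen g' := tlen_mul_of _ _
    have h4 : tlen (t ^ (e : ℤ) * (g' * of h)) = tlen (g' * of h) + 1 := by
      rw [← mul_assoc, tlen_mul_of, h3, ← h2, h1, tlen_of_mul]
    have h5 : tlen (g' * of h) + 1 ≤ tlen (g' * of h * t ^ (e : ℤ)) := by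
      have := hx (x * of h * t ^ (e : ℤ))
      have h6 : (x * of h * t ^ (e : ℤ))⁻¹ * g * (x * of h * t ^ (e : ℤ)) =
          g' * of h * t ^ (e : ℤ) := by
        calc _ = (of h * t ^ (e : ℤ))⁻¹ * (x⁻¹ * g * x) * (of h * t ^ (e : ℤ)) := by group
          _ = _ := by rw [h1]; group
      rw [h6] at this
      omega
    have h6 := tlen_pow_of_cyclicallyReduced h4 (tlen_t_mul_mul_t_of_min h4 h5)
    refine ⟨x * of h, t ^ (e : ℤ) * (g' * of h), ?_, by omega, fun n => by rw [(h6 n).1, h4]⟩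
    have : g = x * (x⁻¹ * g * x) * x⁻¹ := by group
    rw [this, h1]
    group

theorem le_tlen_conj_pow {g : HNNExtension G A B φ} (hg : ∀ n : ℕ, tlen (g ^ n) = n * tlen g)
    (n : ℕ) (x : HNNExtension G A B φ) : n * tlen g ≤ tlen (x⁻¹ * g ^ n * x) := by
  have hpow : ∀ (y : HNNExtension G A B φ) (N : ℕ), tlen (y ^ N) ≤ N * tlen y := by
    intro y N
    induction N with
    | zero => simp [tlen_one]
    | succ N ih =>
      have := tlen_mul_le (y ^ N) y
      rw [pow_succ, add_mul]
      omega
  by_contra hlt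
  push Not at hlt
  have key : ∀ N : ℕ, N * (n * tlen g) ≤ N * tlen (x⁻¹ * g ^ n * x) + 2 * tlen x := by
    intro N
    have h1 : g ^ (n * N) = x * (x⁻¹ * g ^ n * x) ^ N * x⁻¹ := by
      have : (x⁻¹ * g ^ n * x) ^ N = x⁻¹ * (g ^ n) ^ N * x := by
        simpa using conj_pow (a := x⁻¹) (b := g ^ n) (i := N)
      rw [this, pow_mul]
      group
    have h2 := hg (n * N)
    rw [h1] at h2
    have h3 := tlen_mul_le (x * (x⁻¹ * g ^ n * x) ^ N) x⁻¹
    have h4 := tlen_mul_le x ((x⁻¹ * g ^ n * x) ^ N)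
    have h5 := hpow (x⁻¹ * g ^ n * x) N
    rw [tlen_inv] at h3
    have h6 : N * (n * tlen g) = n * N * tlen g := by ring
    omega
  have h1 := key (2 * tlen x + 1)
  nlinarith

/-- If two powers of `g` with exponents of different absolute values are conjugate then `g` is
conjugate into the base group. -/
theorem exists_conj_of_of_zpow_conj {g x : HNNExtension G A B φ} {p q : ℤ} (hpq : |q| < |p|)
    (h : g ^ p * x = x * g ^ q) : ∃ y z, g * y = y * of z := by
  rcases exists_conj_of_or_tlen_pow g with h' | ⟨y, g', hy, h0, hpow⟩
  · exact h'
  · exfalso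
    have hg : g = y * g' * y⁻¹ := by rw [← hy]; group
    have hc : x⁻¹ * g ^ p * x = g ^ q := by rw [mul_assoc, h]; group
    have hlen : ∀ n : ℤ, ∀ w, n.natAbs * tlen g' ≤ tlen (w⁻¹ * g' ^ n * w) := by
      intro n w
      rcases Int.natAbs_eq n with hn | hn
      · have := le_tlen_conj_pow hpow n.natAbs w
        rw [← zpow_natCast, ← hn] at this
        exact this
      · have := le_tlen_conj_pow hpow n.natAbs w
        rw [← zpow_natCast, ← tlen_inv (_ * _)] at this
        have h2 : (w⁻¹ * g' ^ (n.natAbs : ℤ) * w)⁻¹ = w⁻¹ * g' ^ n * w := by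
          conv_rhs => rw [hn]
          group
        rwa [h2] at this
    have h1 := hlen p (y⁻¹ * x * y)
    have h2 : (y⁻¹ * x * y)⁻¹ * g' ^ p * (y⁻¹ * x * y) = g' ^ q := by
      rw [hg, conj_zpow, conj_zpow] at hc
      have := congrArg (fun w => y⁻¹ * w * y) hc
      simpa [mul_assoc] using this
    have h3 : tlen (g' ^ q) = q.natAbs * tlen g' := by
      rcases Int.natAbs_eq q with hn | hn
      · rw [← hpow, ← zpow_natCast, ← hn]
      · rw [← hpow, ← zpow_natCast, ← tlen_inv, ← zpow_neg]
        congr 2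
        omega
    rw [h2, h3] at h1
    have h4 := Nat.le_of_mul_le_mul_right h1 (Nat.pos_of_ne_zero h0)
    rw [Int.abs_eq_natAbs, Int.abs_eq_natAbs] at hpq
    omega

theorem tlen_t_zpow_pow (e : ℤˣ) (j : ℕ) :
    tlen ((t ^ (e : ℤ) : HNNExtension G A B φ) ^ j) = j := by
  have key : tlen ((t ^ (e : ℤ) : HNNExtension G A B φ) ^ j) = j ∧
      tlen ((t ^ (e : ℤ) : HNNExtension G A B φ) ^ (j + 1)) = j + 1 := by
    induction j with
    | zero => simp [tlen_one, tlen_t_zpow]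
    | succ j ih =>
      refine ⟨ih.2, ?_⟩
      have := tlen_t_mul_of_t_mul (φ := φ) (e := e) (g := (t ^ (e : ℤ)) ^ j)
        (by rw [← pow_succ', ih.1, ih.2]) e (h := 1) (fun hh => by
          rcases Int.units_eq_one_or e with h1 | h1 <;> simp [h1] at hh)
      rw [map_one, one_mul, ← pow_succ', ← pow_succ', ih.1] at this
      exact this
  exact key.1

theorem tlen_mul_t_pow {g : HNNExtension G A B φ} {e : ℤˣ}
    (hg : tlen (g * t ^ (e : ℤ)) = tlen g + 1) (j : ℕ) :
    tlen (g * (t ^ (e : ℤ)) ^ j) = tlen g + j := by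
  cases j with
  | zero => simp
  | succ j =>
    rw [pow_succ', tlen_mul_t_mul hg (by rw [← pow_succ', tlen_t_zpow_pow, tlen_t_zpow_pow]),
      tlen_t_zpow_pow]
    omega

theorem tlen_t_pow_mul {g : HNNExtension G A B φ} {e : ℤˣ}
    (hg : tlen (t ^ (e : ℤ) * g) = tlen g + 1) (j : ℕ) :
    tlen ((t ^ (e : ℤ)) ^ j * g) = tlen g + j := by
  have h := tlen_mul_t_pow (g := g⁻¹) (e := -e) (by
    rw [tlen_inv, ← hg, ← tlen_inv]; simp) j
  rw [tlen_inv, ← tlen_inv] at h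
  simpa using h

/-- An element commuting with a power of the stable letter is, up to powers of the stable letter,
in the base group. -/
theorem exists_of_commute_t_pow {g : HNNExtension G A B φ} {j : ℕ} (hj : j ≠ 0)
    (hg : Commute g (t ^ j)) :
    ∃ (i i' : ℤ) (h : G), g = t ^ i * of h * t ^ i' ∧
      Commute (of h : HNNExtension G A B φ) (t ^ j) := by
  obtain ⟨⟨i, i'⟩, hi⟩ : ∃ p : ℤ × ℤ, ∀ q : ℤ × ℤ,
      tlen (t ^ p.1 * g * t ^ p.2) ≤ tlen (t ^ q.1 * g * t ^ q.2) :=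
    exists_forall_apply_le fun p : ℤ × ℤ => tlen (t ^ p.1 * g * t ^ p.2)
  simp only [Prod.forall] at hi
  set g' := t ^ i * g * t ^ i' with hg'
  have hgg : g = t ^ (-i) * g' * t ^ (-i') := by rw [hg']; group
  have hcomm : Commute g' (t ^ j) := by
    have hz : ∀ z : ℤ, Commute (t ^ z) (t ^ j : HNNExtension G A B φ) := fun z => by
      rw [← zpow_natCast]; exact Commute.zpow_zpow_self _ _ _
    exact ((hz i).mul_left hg).mul_left (hz i')
  by_cases h0 : tlen g' = 0
  · obtain ⟨h, hh⟩ := tlen_eq_zero.1 h0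
    exact ⟨-i, -i', h, by rw [hh]; exact hgg, by rwa [hh]⟩
  · exfalso
    have hl : ∀ e : ℤˣ, tlen (t ^ (e : ℤ) * g') = tlen g' + 1 := by
      intro e
      have h1 := hi (e + i) i'
      have h2 : t ^ ((e : ℤ) + i) * g * t ^ i' = t ^ (e : ℤ) * g' := by rw [hg']; group
      rw [h2] at h1
      have := tlen_t_mul_le e g'
      have := tlen_t_mul_ne e g'
      omega
    have hr : ∀ e : ℤˣ, tlen (g' * t ^ (e : ℤ)) = tlen g' + 1 := by
      intro e
      have h1 := hi i (i' + e)
      have h2 : t ^ i * g * t ^ (i' + (e : ℤ)) = g' * t ^ (e : ℤ) := by rw [hg']; group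
      rw [h2] at h1
      have := tlen_mul_t_le g' e
      have := tlen_mul_t_ne g' e
      omega
    have hlr : tlen (t ^ ((-1 : ℤˣ) : ℤ) * g' * t ^ ((1 : ℤˣ) : ℤ)) = tlen g' + 2 := by
      obtain ⟨h, f, p, hp, hpl⟩ := exists_head_of_tlen h0
      have h1 : tlen (t ^ ((-1 : ℤˣ) : ℤ) * of h * t ^ (f : ℤ) : HNNExtension G A B φ) =
          tlen (t ^ ((-1 : ℤˣ) : ℤ) * of h : HNNExtension G A B φ) + 1 := by
        have h2 := tlen_mul_t_le (φ := φ) (t ^ ((-1 : ℤˣ) : ℤ) * of h) f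
        have h3 := tlen_mul_le (t ^ ((-1 : ℤˣ) : ℤ) * of h * t ^ (f : ℤ)) p
        have h4 := hl (-1)
        have h5 : t ^ ((-1 : ℤˣ) : ℤ) * of h * t ^ (f : ℤ) * p = t ^ ((-1 : ℤˣ) : ℤ) * g' := by
          rw [hp]; simp only [mul_assoc]
        rw [h5, h4] at h3
        rw [tlen_mul_of, tlen_t_zpow] at h2 ⊢
        omega
      have h2 : tlen (p * t ^ ((1 : ℤˣ) : ℤ)) = tlen p + 1 ∧
          tlen (t ^ (f : ℤ) * (p * t ^ ((1 : ℤˣ) : ℤ))) =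
            tlen (p * t ^ ((1 : ℤˣ) : ℤ)) + 1 := by
        have h3 := hr 1
        have h4 : g' * t ^ ((1 : ℤˣ) : ℤ) =
            of h * (t ^ (f : ℤ) * (p * t ^ ((1 : ℤˣ) : ℤ))) := by
          rw [hp]; simp only [mul_assoc]
        rw [h4, tlen_of_mul] at h3
        have h5 := tlen_t_mul_le f (p * t ^ ((1 : ℤˣ) : ℤ))
        have h6 := tlen_mul_t_le p 1
        omega
      have h3 := tlen_mul_t_mul h1 h2.2
      have h4 : t ^ ((-1 : ℤˣ) : ℤ) * g' * t ^ ((1 : ℤˣ) : ℤ) =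
          t ^ ((-1 : ℤˣ) : ℤ) * of h * (t ^ (f : ℤ) * (p * t ^ ((1 : ℤˣ) : ℤ))) := by
        rw [hp]; simp only [mul_assoc]
      rw [h4, h3, tlen_mul_of, tlen_t_zpow]
      omega
    have h1 := tlen_mul_t_pow (g := t ^ ((-1 : ℤˣ) : ℤ) * g') (e := 1) (by
      rw [hlr, hl]) j
    have h2 := tlen_mul_t_pow (hr 1) j
    have h3 := tlen_t_pow_mul (g := g' * (t ^ ((1 : ℤˣ) : ℤ)) ^ j) (e := -1) (by
      rw [← mul_assoc, h1, hl, h2]; omega) j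
    have h4 : (t ^ ((-1 : ℤˣ) : ℤ)) ^ j * (g' * (t ^ ((1 : ℤˣ) : ℤ)) ^ j) = g' := by
      have := hcomm.eq
      simp only [Units.val_one, zpow_one, Units.val_neg, zpow_neg]
      rw [this]
      simp
    rw [h4, h2] at h3
    omega

end Dynamics

end HNNExtension

section Cyclic

variable {H : Type*} [Group H]

/-- The isomorphism of `ℤ` with an infinite cyclic subgroup. -/
noncomputable def intEquivZpowers {x : H} (hx : Function.Injective (x ^ · : ℤ → H)) :
    Multiplicative ℤ ≃* Subgroup.zpowers x :=
  MulEquiv.ofBijective ((zpowersHom H x).codRestrict (Subgroup.zpowers x) fun n => ⟨n.toAdd, rfl⟩)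
    ⟨fun _ _ h => hx (congrArg Subtype.val h),
      fun ⟨_, n, hn⟩ => ⟨Multiplicative.ofAdd n, Subtype.ext hn⟩⟩

/-- The isomorphism of infinite cyclic subgroups matching the given generators. -/
noncomputable def zpowersIso {x y : H} (hx : Function.Injective (x ^ · : ℤ → H))
    (hy : Function.Injective (y ^ · : ℤ → H)) : Subgroup.zpowers x ≃* Subgroup.zpowers y :=
  (intEquivZpowers hx).symm.trans (intEquivZpowers hy)

theorem zpowersIso_zpow {x y : H} (hx : Function.Injective (x ^ · : ℤ → H))
    (hy : Function.Injective (y ^ · : ℤ → H)) (n : ℤ) :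
    (zpowersIso hx hy ⟨x ^ n, n, rfl⟩ : H) = y ^ n := by
  have : (intEquivZpowers hx).symm ⟨x ^ n, n, rfl⟩ = Multiplicative.ofAdd n := by
    rw [MulEquiv.symm_apply_eq]
    rfl
  rw [zpowersIso, MulEquiv.trans_apply, this]
  rfl

/-- The HNN extension in which the stable letter conjugates `x` to `y`. -/
abbrev CyclicHNN {x y : H} (hx : Function.Injective (x ^ · : ℤ → H))
    (hy : Function.Injective (y ^ · : ℤ → H)) : Type _ :=
  HNNExtension H (Subgroup.zpowers x) (Subgroup.zpowers y) (zpowersIso hx hy)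

namespace CyclicHNN

open HNNExtension

variable {x y : H} {hx : Function.Injective (x ^ · : ℤ → H)}
  {hy : Function.Injective (y ^ · : ℤ → H)}

theorem t_mul_of_zpow (n : ℤ) : (t * of (x ^ n) : CyclicHNN hx hy) = of (y ^ n) * t := by
  have := t_mul_of (φ := zpowersIso hx hy) ⟨x ^ n, n, rfl⟩
  rwa [zpowersIso_zpow] at this

theorem t_mul_of_self : (t * of x : CyclicHNN hx hy) = of y * t := by
  simpa using t_mul_of_zpow (hx := hx) (hy := hy) 1

/-- The homomorphism defined by a homomorphism on the base and an image of the stable letter. -/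
noncomputable def lift {K : Type*} [Group K] (f : H →* K) (s : K) (hs : s * f x = f y * s) :
    CyclicHNN hx hy →* K :=
  HNNExtension.lift f s (by
    rintro ⟨_, n, rfl⟩
    have h : s * f x * s⁻¹ = f y := by rw [hs]; group
    simp only [zpowersIso_zpow, map_zpow, ← h, conj_zpow]
    group)

@[simp]
theorem lift_t {K : Type*} [Group K] (f : H →* K) (s : K) (hs : s * f x = f y * s) :
    lift (hx := hx) (hy := hy) f s hs t = s := HNNExtension.lift_t _ _ _

@[simp]
theorem lift_of {K : Type*} [Group K] (f : H →* K) (s : K) (hs : s * f x = f y * s) (h : H) :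
    lift (hx := hx) (hy := hy) f s hs (of h) = f h := HNNExtension.lift_of _ _ _ _

theorem exists_pinch {g : CyclicHNN hx hy} (hg : tlen g ≠ 0) {u v : H}
    (hc : of u * g = g * of v) :
    (∃ z n g', g = of z * (t * g') ∧ tlen g = tlen g' + 1 ∧ z⁻¹ * u * z = y ^ (n : ℤ) ∧
      of (x ^ n) * g' = g' * of v) ∨
    (∃ z n g', g = of z * (t⁻¹ * g') ∧ tlen g = tlen g' + 1 ∧ z⁻¹ * u * z = x ^ (n : ℤ) ∧
      of (y ^ n) * g' = g' * of v) := by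
  obtain ⟨z, e, g', h1, h2, h3, w, -, h5, h6⟩ := exists_pinch_of_conj hg hc
  rcases Int.units_eq_one_or e with rfl | rfl
  · left
    obtain ⟨n, hn⟩ := h3
    dsimp only at hn
    refine ⟨z, n, g', by simpa using h1, h2, hn.symm, ?_⟩
    rw [← hn] at h5
    simp only [Units.val_one, zpow_one, ← t_mul_of_zpow, mul_right_inj] at h5
    rw [h5, h6]
  · right
    obtain ⟨n, hn⟩ := h3
    dsimp only at hn
    refine ⟨z, n, g', by simpa using h1, h2, hn.symm, ?_⟩
    rw [← hn] at h5
    have h7 : (of (x ^ n) * t⁻¹ : CyclicHNN hx hy) = t⁻¹ * of (y ^ n) := by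
      rw [eq_inv_mul_iff_mul_eq, ← mul_assoc, t_mul_of_zpow]
      group
    simp only [Units.val_neg, Units.val_one, Int.reduceNeg, zpow_neg, zpow_one, h7,
      mul_right_inj] at h5
    rw [h5, h6]

end CyclicHNN

end Cyclic

theorem Multiplicative.ofAdd_zpow_injective {m : ℤ} (hm : m ≠ 0) :
    Function.Injective ((Multiplicative.ofAdd m) ^ · : ℤ → Multiplicative ℤ) := by
  intro i j h
  have := congrArg Multiplicative.toAdd h
  simpa [hm] using this

/-- The Baumslag–Solitar group `⟨a, b ; b aᵐ b⁻¹ = aˡ⟩`. -/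
abbrev BaumslagSolitar (l m : ℤ) [NeZero l] [NeZero m] : Type :=
  CyclicHNN (Multiplicative.ofAdd_zpow_injective (NeZero.ne m))
    (Multiplicative.ofAdd_zpow_injective (NeZero.ne l))

namespace BaumslagSolitar

open HNNExtension

variable {l m : ℤ} [NeZero l] [NeZero m]

/-- The generator `a`. -/
noncomputable def a : BaumslagSolitar l m := of (.ofAdd 1)

/-- The generator `b`. -/
noncomputable def b : BaumslagSolitar l m := t

theorem a_zpow (n : ℤ) : (a ^ n : BaumslagSolitar l m) = of (.ofAdd n) := by
  rw [a, ← map_zpow, ← ofAdd_zsmul, smul_eq_mul, mul_one]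

theorem a_zpow_injective : Function.Injective (a ^ · : ℤ → BaumslagSolitar l m) := by
  intro i j h
  simp only [a_zpow] at h
  exact Multiplicative.ofAdd.injective (of_injective _ h)

theorem rel : (b * a ^ m : BaumslagSolitar l m) = a ^ l * b := by
  rw [a_zpow, a_zpow]
  exact CyclicHNN.t_mul_of_self

theorem rel_zpow (n : ℤ) : (b * a ^ (m * n) : BaumslagSolitar l m) = a ^ (l * n) * b := by
  have : (b * a ^ m * b⁻¹ : BaumslagSolitar l m) = a ^ l := by rw [rel]; group
  rw [zpow_mul, zpow_mul, ← this, conj_zpow]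
  group

theorem tlen_eq_zero_iff {g : BaumslagSolitar l m} : tlen g = 0 ↔ ∃ n : ℤ, a ^ n = g := by
  rw [tlen_eq_zero]
  constructor
  · rintro ⟨n, rfl⟩
    exact ⟨n.toAdd, a_zpow _⟩
  · rintro ⟨n, rfl⟩
    exact ⟨_, (a_zpow _).symm⟩

/-- The homomorphism determined by the images of the generators. -/
noncomputable def lift {K : Type*} [Group K] (α β : K) (h : β * α ^ m = α ^ l * β) :
    BaumslagSolitar l m →* K :=
  CyclicHNN.lift (zpowersHom K α) β (by simpa using h)

@[simp]
theorem lift_a {K : Type*} [Group K] (α β : K) (h : β * α ^ m = α ^ l * β) :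
    lift α β h a = α := by
  simp [lift, a]

@[simp]
theorem lift_b {K : Type*} [Group K] (α β : K) (h : β * α ^ m = α ^ l * β) :
    lift α β h b = β := by
  simp [lift, b]

@[elab_as_elim]
theorem induction_on {p : BaumslagSolitar l m → Prop} (g : BaumslagSolitar l m)
    (ha : p a) (hb : p b) (mul : ∀ x y, p x → p y → p (x * y)) (inv : ∀ x, p x → p x⁻¹) : p g := by
  have h1 : p 1 := by simpa using mul _ _ ha (inv _ ha)
  induction g using HNNExtension.induction_on with
  | of g =>
    have : (of g : BaumslagSolitar l m) = a ^ g.toAdd := by rw [a_zpow]; rfl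
    rw [this]
    induction g.toAdd with
    | zero => simpa using h1
    | succ i ih => rw [zpow_add_one]; exact mul _ _ ih ha
    | pred i ih => rw [zpow_sub_one]; exact mul _ _ ih (inv _ ha)
  | t => exact hb
  | mul x y hx hy => exact mul _ _ hx hy
  | inv x hx => exact inv _ hx

theorem hom_ext {K : Type*} [Group K] {f g : BaumslagSolitar l m →* K} (ha : f a = g a)
    (hb : f b = g b) : f = g := by
  refine MonoidHom.ext fun x => ?_
  induction x using induction_on with
  | ha => exact ha
  | hb => exact hb
  | mul x y hx hy => rw [map_mul, map_mul, hx, hy]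
  | inv x hx => rw [map_inv, map_inv, hx]

/-- The exponent sum of `b`. -/
noncomputable def bExp : BaumslagSolitar l m →* Multiplicative ℤ :=
  lift 1 (.ofAdd 1) (by simp)

@[simp] theorem bExp_a : bExp (a : BaumslagSolitar l m) = 1 := lift_a _ _ _

@[simp] theorem bExp_b : bExp (b : BaumslagSolitar l m) = .ofAdd 1 := lift_b _ _ _

theorem b_zpow_injective : Function.Injective (b ^ · : ℤ → BaumslagSolitar l m) := by
  intro i j h
  have := congrArg (fun g => (bExp g).toAdd) h
  simpa using this

/-- The affine action on `ℚ`: `a` is the translation by one and `b` the homothety by `l / m`. -/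
noncomputable def affine : BaumslagSolitar l m →* Equiv.Perm ℚ :=
  lift (Equiv.addRight 1) (Equiv.mulRight₀ (l / m : ℚ)
    (div_ne_zero (Int.cast_ne_zero.2 (NeZero.ne l)) (Int.cast_ne_zero.2 (NeZero.ne m)))) (by
      have hm : (m : ℚ) ≠ 0 := Int.cast_ne_zero.2 (NeZero.ne m)
      ext z
      simp [add_mul]
      field_simp)

theorem affine_apply (g : BaumslagSolitar l m) :
    ∃ β : ℚ, ∀ z, affine g z = (l / m : ℚ) ^ (bExp g).toAdd * z + β := by
  have hl : (l : ℚ) ≠ 0 := Int.cast_ne_zero.2 (NeZero.ne l)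
  have hm : (m : ℚ) ≠ 0 := Int.cast_ne_zero.2 (NeZero.ne m)
  have hlm : (l / m : ℚ) ≠ 0 := div_ne_zero hl hm
  induction g using induction_on with
  | ha => exact ⟨1, fun z => by simp [affine]⟩
  | hb => exact ⟨0, fun z => by simp [affine, mul_comm]⟩
  | mul x y hx hy =>
    obtain ⟨β, hβ⟩ := hx
    obtain ⟨γ, hγ⟩ := hy
    refine ⟨(l / m : ℚ) ^ (bExp x).toAdd * γ + β, fun z => ?_⟩
    rw [map_mul, Equiv.Perm.mul_apply, hγ, hβ, map_mul, toAdd_mul, zpow_add₀ hlm]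
    ring
  | inv x hx =>
    obtain ⟨β, hβ⟩ := hx
    refine ⟨- ((l / m : ℚ) ^ (-(bExp x).toAdd) * β), fun z => ?_⟩
    rw [map_inv, Equiv.Perm.inv_eq_iff_eq, hβ, map_inv, toAdd_inv, zpow_neg]
    field_simp
    ring

/-- Conjugating a power of `a` into a power of `a` scales the exponent by a power of `l / m`. -/
theorem eq_mul_zpow_of_conj {x y : ℤ} {g : BaumslagSolitar l m} (h : a ^ x * g = g * a ^ y) :
    (x : ℚ) = (l / m : ℚ) ^ (bExp g).toAdd * y := by
  obtain ⟨β, hβ⟩ := affine_apply g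
  have ha : ∀ (n : ℤ) (z : ℚ), affine (a ^ n : BaumslagSolitar l m) z = z + n := by
    intro n z
    simp [affine]
  have := congrArg (fun w => affine w 0) h
  simp only [map_mul, Equiv.Perm.mul_apply, ha, hβ] at this
  linarith

/-- One step of conjugation of powers of `a` by `b` or its inverse. -/
def Step (l m x y : ℤ) : Prop := ∃ z, (x = l * z ∧ y = m * z) ∨ (x = m * z ∧ y = l * z)

theorem reflTransGen_step_of_conj {x y : ℤ} {g : BaumslagSolitar l m}
    (h : a ^ x * g = g * a ^ y) : Relation.ReflTransGen (Step l m) x y := by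
  induction hn : tlen g generalizing g x with
  | zero =>
    obtain ⟨n, rfl⟩ := tlen_eq_zero_iff.1 hn
    rw [← zpow_add, ← zpow_add] at h
    have := a_zpow_injective h
    obtain rfl : x = y := by omega
    exact .refl
  | succ n ih =>
    have h' := h
    rw [a_zpow, a_zpow] at h'
    rcases CyclicHNN.exists_pinch (by omega) h' with
      ⟨z, i, g', -, h2, h3, h4⟩ | ⟨z, i, g', -, h2, h3, h4⟩ <;>
    · have h5 := congrArg Multiplicative.toAdd h3
      simp only [toAdd_mul, toAdd_inv, toAdd_ofAdd, toAdd_zpow, smul_eq_mul] at h5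
      rw [← ofAdd_zsmul, smul_eq_mul, ← a_zpow, ← a_zpow] at h4
      refine .head ⟨i, ?_⟩ (ih h4 (by omega))
      first
        | exact Or.inl ⟨by linarith, by ring⟩
        | exact Or.inr ⟨by linarith, by ring⟩

theorem exists_conj_a_zpow {g x : BaumslagSolitar l m} {p q : ℤ} (hpq : |q| < |p|)
    (h : g ^ p * x = x * g ^ q) : ∃ y n, g * y = y * a ^ (n : ℤ) := by
  obtain ⟨y, z, hy⟩ := exists_conj_of_of_zpow_conj hpq h
  exact ⟨y, z.toAdd, by rw [hy, a_zpow]; rfl⟩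

theorem exists_of_commute_b_zpow {g : BaumslagSolitar l m} {j : ℤ} (hj : j ≠ 0)
    (h : Commute g (b ^ j)) :
    ∃ i x i' : ℤ, g = b ^ i * a ^ x * b ^ i' ∧ Commute (a ^ x : BaumslagSolitar l m) (b ^ j) := by
  have h1 : ∀ w : BaumslagSolitar l m, Commute w (b ^ j) ↔ Commute w (t ^ j.natAbs) := by
    intro w
    rcases Int.natAbs_eq j with h2 | h2
    · conv_lhs => rw [h2, zpow_natCast]
      rfl
    · conv_lhs => rw [h2, zpow_neg, zpow_natCast, Commute.inv_right_iff]
      rfl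
  obtain ⟨i, i', x, h2, h3⟩ := exists_of_commute_t_pow (Int.natAbs_ne_zero.2 hj) ((h1 g).1 h)
  have h4 : (of x : BaumslagSolitar l m) = a ^ x.toAdd := by rw [a_zpow]; rfl
  rw [h4] at h2 h3
  exact ⟨i, x.toAdd, i', h2, (h1 _).2 h3⟩

theorem one_ne_div_zpow {r : ℚ} (hr : 1 < |r|) {j : ℤ} (hj : j ≠ 0) : r ^ j ≠ 1 := by
  intro h
  have h1 : |r| ^ j = |r| ^ (0 : ℤ) := by rw [← abs_zpow, h]; simp
  exact hj (zpow_right_injective₀ (by linarith) (by linarith) h1)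

theorem one_lt_abs_div {l m : ℤ} [NeZero m] (hlm : |m| < |l|) : 1 < |(l / m : ℚ)| := by
  have hm : 0 < |(m : ℚ)| := abs_pos.2 (Int.cast_ne_zero.2 (NeZero.ne m))
  rw [abs_div, one_lt_div hm]
  exact_mod_cast hlm

/-- Powers of `b` are self-centralizing when `|m| < |l|`. -/
theorem exists_eq_b_zpow_of_conj (hlm : |m| < |l|) {g : BaumslagSolitar l m} {i j : ℤ}
    (hi : i ≠ 0) (h : b ^ i * g = g * b ^ j) : ∃ n : ℤ, g = b ^ n := by
  have hij : i = j := by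
    have := congrArg (fun g => (bExp g).toAdd) h
    simp at this
    omega
  subst hij
  obtain ⟨n, x, n', h1, h2⟩ := exists_of_commute_b_zpow hi h.symm
  have h3 := eq_mul_zpow_of_conj h2.eq
  have h4 := one_ne_div_zpow (one_lt_abs_div hlm) hi
  simp only [map_zpow, bExp_b, toAdd_zpow, toAdd_ofAdd, smul_eq_mul, mul_one] at h3
  have h5 : (x : ℚ) = 0 := by
    by_contra h6
    exact h4 (mul_right_cancel₀ h6 (by linarith))
  have h6 : x = 0 := by exact_mod_cast h5
  exact ⟨n + n', by rw [h1, h6, zpow_add]; simp⟩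

end BaumslagSolitar

/-- The defining relation of the group `G(l,m;k)` for a pair of elements of a group. -/
def BrunnerRel {K : Type*} [Group K] (l m k : ℤ) (α τ : K) : Prop :=
  (τ⁻¹ * α ^ k * τ)⁻¹ * α ^ l * (τ⁻¹ * α ^ k * τ) = α ^ m

theorem BrunnerRel.mul_eq {K : Type*} [Group K] {l m k : ℤ} {α τ : K} (h : BrunnerRel l m k α τ) :
    α ^ l * (τ⁻¹ * α ^ k * τ) = (τ⁻¹ * α ^ k * τ) * α ^ m := by
  rw [← h]
  group

theorem BrunnerRel.map {K L : Type*} [Group K] [Group L] {l m k : ℤ} {α τ : K}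
    (h : BrunnerRel l m k α τ) (f : K →* L) : BrunnerRel l m k (f α) (f τ) := by
  have := congrArg f h
  simpa [BrunnerRel] using this

theorem BrunnerRel.conj_zpow {K : Type*} [Group K] {l m k : ℤ} {α τ : K}
    (h : BrunnerRel l m k α τ) (n : ℤ) :
    (τ⁻¹ * α ^ k * τ)⁻¹ * α ^ (l * n) * (τ⁻¹ * α ^ k * τ) = α ^ (m * n) := by
  have h1 : (τ⁻¹ * α ^ k * τ)⁻¹ * (α ^ l) ^ n * (τ⁻¹ * α ^ k * τ) =
      ((τ⁻¹ * α ^ k * τ)⁻¹ * α ^ l * (τ⁻¹ * α ^ k * τ)) ^ n := by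
    simpa using (_root_.conj_zpow (i := n) (a := (τ⁻¹ * α ^ k * τ)⁻¹) (b := α ^ l)).symm
  rw [zpow_mul, zpow_mul, h1, h]

theorem BrunnerRel.conj_zpow_pow {K : Type*} [Group K] {q k : ℤ} {α τ : K}
    (h : BrunnerRel q 1 k α τ) (S : ℕ) :
    ((τ⁻¹ * α ^ k * τ) ^ S)⁻¹ * α ^ (q ^ S) * (τ⁻¹ * α ^ k * τ) ^ S = α := by
  induction S with
  | zero => simp
  | succ S ih =>
    have h1 := h.conj_zpow (q ^ S)
    rw [one_mul] at h1
    set β := τ⁻¹ * α ^ k * τ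
    calc _ = (β ^ S)⁻¹ * (β⁻¹ * α ^ (q * q ^ S) * β) * β ^ S := by
          rw [pow_succ q, mul_comm q, pow_succ']; group
      _ = _ := by rw [h1, ih]

namespace BrunnerGroup

variable {l m k : ℤ}

/-- The generator `a`. -/
def a : BrunnerGroup l m k := PresentedGroup.of 0

/-- The generator `t`. -/
def t : BrunnerGroup l m k := PresentedGroup.of 1

theorem rel : BrunnerRel l m k (a : BrunnerGroup l m k) t := by
  have h : PresentedGroup.mk {brunnerRelator l m k} (brunnerRelator l m k) = 1 :=
    PresentedGroup.one_of_mem rfl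
  change t⁻¹ * a ^ (-k) * t * a ^ l * t⁻¹ * a ^ k * t * (a ^ m)⁻¹ = 1 at h
  rw [mul_inv_eq_one] at h
  rw [BrunnerRel, ← h]
  group

/-- The homomorphism determined by a pair of elements satisfying the defining relation. -/
def lift {K : Type*} [Group K] (α τ : K) (h : BrunnerRel l m k α τ) : BrunnerGroup l m k →* K :=
  PresentedGroup.toGroup (f := ![α, τ]) (by
    rintro _ rfl
    simp only [brunnerRelator, map_mul, map_zpow, map_inv, FreeGroup.lift_apply_of,
      Matrix.cons_val_zero, Matrix.cons_val_one]
    rw [mul_inv_eq_one, ← h]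
    group)

@[simp]
theorem lift_a {K : Type*} [Group K] (α τ : K) (h : BrunnerRel l m k α τ) : lift α τ h a = α :=
  PresentedGroup.toGroup.of _

@[simp]
theorem lift_t {K : Type*} [Group K] (α τ : K) (h : BrunnerRel l m k α τ) : lift α τ h t = τ :=
  PresentedGroup.toGroup.of _

theorem hom_ext {K : Type*} [Group K] {f g : BrunnerGroup l m k →* K} (ha : f a = g a)
    (ht : f t = g t) : f = g := by
  refine PresentedGroup.ext fun x => ?_
  fin_cases x
  · exact ha
  · exact ht

theorem eq_top_of_mem {S : Subgroup (BrunnerGroup l m k)} (ha : a ∈ S) (ht : t ∈ S) : S = ⊤ := by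
  rw [eq_top_iff, ← PresentedGroup.closure_range_of, Subgroup.closure_le]
  rintro _ ⟨x, rfl⟩
  fin_cases x
  · exact ha
  · exact ht

/-- An isomorphism given by mutually inverse assignments of the generators. -/
def mulEquivOfLift {l' m' k' : ℤ} {α τ : BrunnerGroup l' m' k'} {α' τ' : BrunnerGroup l m k}
    (h : BrunnerRel l m k α τ) (h' : BrunnerRel l' m' k' α' τ')
    (ha : lift α' τ' h' α = a) (ht : lift α' τ' h' τ = t)
    (ha' : lift α τ h α' = a) (ht' : lift α τ h τ' = t) :
    BrunnerGroup l m k ≃* BrunnerGroup l' m' k' :=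
  MonoidHom.toMulEquiv (lift α τ h) (lift α' τ' h')
    (hom_ext (by simpa using ha) (by simpa using ht))
    (hom_ext (by simpa using ha') (by simpa using ht'))

theorem BrunnerRel_neg {K : Type*} [Group K] {α τ : K} (h : BrunnerRel l m k α τ) :
    BrunnerRel l m (-k) α⁻¹ τ := by
  have := congrArg (·⁻¹) h
  simp only [BrunnerRel, inv_zpow', neg_neg] at this ⊢
  rw [zpow_neg α m, ← this]
  group

theorem nonempty_mulEquiv_neg (l m k : ℤ) :
    Nonempty (BrunnerGroup l m k ≃* BrunnerGroup l m (-k)) :=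
  ⟨mulEquivOfLift (α := a⁻¹) (τ := t) (α' := a⁻¹) (τ' := t)
    (by simpa using BrunnerRel_neg (rel (l := l) (m := m) (k := -k)))
    (BrunnerRel_neg rel) (by simp) (by simp) (by simp) (by simp)⟩

theorem nonempty_mulEquiv_of_step (l m z : ℤ) :
    Nonempty (BrunnerGroup l m (l * z) ≃* BrunnerGroup l m (m * z)) := by
  have h1 : ∀ {K : Type} [Group K] {α τ : K}, BrunnerRel l m (m * z) α τ →
      (τ⁻¹ * α ^ (m * z) * τ * τ)⁻¹ * α ^ (l * z) * (τ⁻¹ * α ^ (m * z) * τ * τ) =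
        τ⁻¹ * α ^ (m * z) * τ := by
    intro K _ α τ h
    have h2 := h.conj_zpow z
    set β := τ⁻¹ * α ^ (m * z) * τ with hβ
    calc _ = τ⁻¹ * (β⁻¹ * α ^ (l * z) * β) * τ := by group
      _ = _ := by rw [h2, hβ]
  have h2 : ∀ {K : Type} [Group K] {α τ : K}, BrunnerRel l m (l * z) α τ →
      ((τ⁻¹ * α ^ (l * z) * τ)⁻¹ * τ)⁻¹ * α ^ (m * z) * ((τ⁻¹ * α ^ (l * z) * τ)⁻¹ * τ) =
        τ⁻¹ * α ^ (l * z) * τ := by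
    intro K _ α τ h
    have h2 := h.conj_zpow z
    rw [← h2]
    group
  have r1 := h1 (rel (l := l) (m := m) (k := m * z))
  have r2 := h2 (rel (l := l) (m := m) (k := l * z))
  refine ⟨mulEquivOfLift (α := a) (τ := t⁻¹ * a ^ (m * z) * t * t)
    (α' := a) (τ' := (t⁻¹ * a ^ (l * z) * t)⁻¹ * t) ?_ ?_ (lift_a _ _ _) ?_ (lift_a _ _ _) ?_⟩
  · rw [BrunnerRel, r1]
    exact rel
  · rw [BrunnerRel, r2]
    exact rel
  · simp only [map_mul, map_inv, map_zpow, lift_a, lift_t]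
    rw [r2]
    group
  · simp only [map_mul, map_inv, map_zpow, lift_a, lift_t]
    rw [r1]
    group

theorem nonempty_mulEquiv_of_dvd_pow {q d : ℤ} {S : ℕ} (h : d ∣ q ^ S) (k : ℤ) :
    Nonempty (BrunnerGroup q 1 k ≃* BrunnerGroup q 1 (d * k)) := by
  obtain ⟨c, hc⟩ := h
  have r := rel (l := q) (m := 1) (k := k)
  have r' := rel (l := q) (m := 1) (k := d * k)
  set β : BrunnerGroup q 1 k := t⁻¹ * a ^ k * t with hβ
  have h3 : ∀ n : ℤ, ((β ^ S)⁻¹ * a ^ c * β ^ S) ^ n = (β ^ S)⁻¹ * a ^ (c * n) * β ^ S := by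
    intro n
    simpa [zpow_mul] using conj_zpow (i := n) (a := (β ^ S)⁻¹) (b := (a : BrunnerGroup q 1 k) ^ c)
  have k1 : ((β ^ S)⁻¹ * a ^ c * β ^ S) ^ d = a := by
    rw [h3, mul_comm c, ← hc, r.conj_zpow_pow]
  have k3 : BrunnerRel q 1 k (a ^ d) (t : BrunnerGroup q 1 (d * k)) := by
    have := r'.conj_zpow d
    rw [BrunnerRel, ← zpow_mul, ← zpow_mul, mul_comm d q, this, one_mul, zpow_one]
  refine ⟨mulEquivOfLift (α := a ^ d) (τ := t)
    (α' := (β ^ S)⁻¹ * a ^ c * β ^ S) (τ' := t) k3 ?_ ?_ (lift_t _ _ _) ?_ (lift_t _ _ _)⟩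
  · rw [BrunnerRel, zpow_mul _ d, k1, zpow_one, h3]
    have h4 := r.conj_zpow c
    rw [one_mul, ← hβ] at h4
    rw [← hβ]
    calc _ = (β ^ S)⁻¹ * (β⁻¹ * a ^ (q * c) * β) * β ^ S := by
          rw [mul_comm q]
          clear_value β
          group
      _ = _ := by rw [h4]
  · rw [map_zpow, lift_a, k1]
  · have h5 := r'.conj_zpow_pow S
    simp only [hβ, map_mul, map_inv, map_zpow, map_pow, lift_a, lift_t, ← zpow_mul]
    rwa [← hc]

end BrunnerGroup

/-- The group `G(l,m;k)` as an HNN extension of a Baumslag–Solitar group. -/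
abbrev BrunnerHNN (l m k : ℤ) [NeZero l] [NeZero m] [NeZero k] : Type :=
  CyclicHNN (BaumslagSolitar.b_zpow_injective (l := l) (m := m))
    (y := BaumslagSolitar.a ^ k) (fun i j h => by
      simp only [← zpow_mul] at h
      exact mul_left_cancel₀ (NeZero.ne k) (BaumslagSolitar.a_zpow_injective h))

namespace BrunnerHNN

open BaumslagSolitar

variable {l m k : ℤ} [NeZero l] [NeZero m] [NeZero k]

/-- The inclusion of the base group. -/
noncomputable def of : BaumslagSolitar l m →* BrunnerHNN l m k := HNNExtension.of

/-- The stable letter. -/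
noncomputable def t : BrunnerHNN l m k := HNNExtension.t

theorem of_injective : Function.Injective (of : BaumslagSolitar l m →* BrunnerHNN l m k) :=
  HNNExtension.of_injective _

/-- The homomorphism determined on the base group and the stable letter. -/
noncomputable def lift {K : Type*} [Group K] (f : BaumslagSolitar l m →* K) (s : K)
    (hs : s * f b = f (a ^ k) * s) : BrunnerHNN l m k →* K :=
  CyclicHNN.lift f s hs

@[simp]
theorem lift_of {K : Type*} [Group K] (f : BaumslagSolitar l m →* K) (s : K)
    (hs : s * f b = f (a ^ k) * s) (h : BaumslagSolitar l m) : lift f s hs (of h) = f h :=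
  CyclicHNN.lift_of _ _ _ _

@[simp]
theorem lift_t {K : Type*} [Group K] (f : BaumslagSolitar l m →* K) (s : K)
    (hs : s * f b = f (a ^ k) * s) : lift f s hs t = s :=
  CyclicHNN.lift_t _ _ _

theorem hom_ext {K : Type*} [Group K] {f g : BrunnerHNN l m k →* K}
    (h : ∀ x, f (of x) = g (of x)) (ht : f t = g t) : f = g :=
  HNNExtension.hom_ext (MonoidHom.ext h) ht

theorem t_mul_b_zpow (n : ℤ) : (t * of (b ^ n) : BrunnerHNN l m k) = of (a ^ (k * n)) * t := by
  rw [zpow_mul]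
  exact CyclicHNN.t_mul_of_zpow n

theorem t_inv_mul_a_zpow (n : ℤ) :
    (t⁻¹ * of (a ^ (k * n)) * t : BrunnerHNN l m k) = of (b ^ n) := by
  rw [mul_assoc, ← t_mul_b_zpow]
  group

theorem brunnerRel : BrunnerRel l m k (of a) (t : BrunnerHNN l m k) := by
  have := t_inv_mul_a_zpow (l := l) (m := m) (k := k) 1
  rw [mul_one, map_zpow, zpow_one] at this
  rw [BrunnerRel, this, ← map_inv, ← map_zpow, ← map_zpow, ← map_mul, ← map_mul, mul_assoc, ← rel]
  group

/-- The exponent sum of `t`. -/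
noncomputable def tExp : BrunnerHNN l m k →* Multiplicative ℤ :=
  lift 1 (Multiplicative.ofAdd 1) (by simp)

@[simp] theorem tExp_of (h : BaumslagSolitar l m) : tExp (of h : BrunnerHNN l m k) = 1 :=
  lift_of _ _ _ _

@[simp] theorem tExp_t : tExp (t : BrunnerHNN l m k) = Multiplicative.ofAdd 1 :=
  lift_t _ _ _

theorem hom_ext_a {K : Type*} [Group K] {f g : BrunnerHNN l m k →* K}
    (h : f (of a) = g (of a)) (ht : f t = g t) : f = g := by
  refine hom_ext (DFunLike.congr_fun (BaumslagSolitar.hom_ext (f := f.comp of) (g := g.comp of)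
    h ?_)) ht
  have := t_inv_mul_a_zpow (l := l) (m := m) (k := k) 1
  rw [mul_one, map_zpow, zpow_one] at this
  rw [MonoidHom.comp_apply, MonoidHom.comp_apply, ← this]
  simp [h, ht]

/-- The homomorphism from the HNN extension to `G(l,m;k)`. -/
noncomputable def toBrunnerGroup : BrunnerHNN l m k →* BrunnerGroup l m k :=
  lift (BaumslagSolitar.lift BrunnerGroup.a
    (BrunnerGroup.t⁻¹ * BrunnerGroup.a ^ k * BrunnerGroup.t) BrunnerGroup.rel.mul_eq.symm)
    BrunnerGroup.t (by rw [map_zpow, lift_a, lift_b]; group)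

theorem toBrunnerGroup_a : toBrunnerGroup (of a : BrunnerHNN l m k) = BrunnerGroup.a := by
  rw [toBrunnerGroup, lift_of, lift_a]

theorem toBrunnerGroup_t : toBrunnerGroup (t : BrunnerHNN l m k) = BrunnerGroup.t :=
  lift_t _ _ _

/-- The identification of `G(l,m;k)` with an HNN extension. -/
noncomputable def equiv : BrunnerGroup l m k ≃* BrunnerHNN l m k :=
  MonoidHom.toMulEquiv (BrunnerGroup.lift (of a) t brunnerRel) toBrunnerGroup
    (BrunnerGroup.hom_ext
      (by rw [MonoidHom.comp_apply, BrunnerGroup.lift_a, toBrunnerGroup_a]; rfl)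
      (by rw [MonoidHom.comp_apply, BrunnerGroup.lift_t, toBrunnerGroup_t]; rfl))
    (hom_ext_a
      (by rw [MonoidHom.comp_apply, toBrunnerGroup_a, BrunnerGroup.lift_a]; rfl)
      (by rw [MonoidHom.comp_apply, toBrunnerGroup_t, BrunnerGroup.lift_t]; rfl))

theorem equiv_a : equiv (BrunnerGroup.a : BrunnerGroup l m k) = of a :=
  BrunnerGroup.lift_a (of a) (t : BrunnerHNN l m k) brunnerRel

theorem equiv_t : equiv (BrunnerGroup.t : BrunnerGroup l m k) = t :=
  BrunnerGroup.lift_t (of a) (t : BrunnerHNN l m k) brunnerRel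

end BrunnerHNN

namespace BrunnerHNN

open BaumslagSolitar HNNExtension

variable {l m k : ℤ} [NeZero l] [NeZero m] [NeZero k]

theorem eq_zero_of_conj_eq_b_zpow {g : BaumslagSolitar l m} {n i : ℤ}
    (h : a ^ n * g = g * b ^ i) : i = 0 ∧ n = 0 := by
  have h1 := congrArg (fun w => (bExp w).toAdd) h
  simp only [map_mul, map_zpow, bExp_a, bExp_b, one_zpow, one_mul, toAdd_mul, toAdd_zpow,
    toAdd_ofAdd, smul_eq_mul, mul_one, left_eq_add] at h1
  subst h1
  refine ⟨rfl, a_zpow_injective (l := l) (m := m) ?_⟩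
  simpa using h

/-- The conjugates of a nontrivial power of `a` which lie in the base group. -/
theorem of_or_of_conj (hlm : |m| < |l|) {n : ℤ} (hn : n ≠ 0) {g : BrunnerHNN l m k}
    {y : BaumslagSolitar l m} (h : of (a ^ n) * g = g * of y) :
    (∃ x, g = of x) ∨ ∃ x x' i, g = of x * t * of x' ∧ a ^ n * x = x * a ^ (k * i) ∧
      b ^ i * x' = x' * y := by
  by_cases h0 : tlen g = 0
  · obtain ⟨x, hx⟩ := tlen_eq_zero.1 h0
    exact Or.inl ⟨x, hx.symm⟩
  right
  rcases CyclicHNN.exists_pinch h0 h with ⟨z, i, g', h1, h2, h3, h4⟩ | ⟨z, i, g', h1, h2, h3, h4⟩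
  · have h3' : a ^ n * z = z * a ^ (k * i) := by rw [zpow_mul, ← h3]; group
    have hi : i ≠ 0 := by
      rintro rfl
      refine hn (a_zpow_injective (l := l) (m := m) ?_)
      simpa using h3'
    by_cases h5 : tlen g' = 0
    · obtain ⟨x, rfl⟩ := tlen_eq_zero.1 h5
      refine ⟨z, x, i, by rw [h1, ← mul_assoc]; rfl, h3', ?_⟩
      rw [← map_mul, ← map_mul] at h4
      exact HNNExtension.of_injective _ h4
    · exfalso
      rcases CyclicHNN.exists_pinch h5 h4 with
        ⟨w, j, g'', e1, e2, e3, e4⟩ | ⟨w, j, g'', e1, e2, e3, e4⟩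
      · refine hi (eq_zero_of_conj_eq_b_zpow (l := l) (m := m) (n := k * j) (g := w⁻¹) ?_).1
        rw [zpow_mul, ← e3]
        group
      · obtain ⟨r, rfl⟩ := exists_eq_b_zpow_of_conj hlm (g := w) (i := i) (j := j) hi
          (by rw [← e3]; group)
        have e5 : g = of (z * a ^ (k * r)) * g'' := by
          rw [h1, e1]
          have := t_mul_b_zpow (l := l) (m := m) (k := k) r
          calc _ = of z * (t * of (b ^ r)) * t⁻¹ * g'' := by
                simp only [mul_assoc]; rfl
            _ = _ := by rw [this, map_mul]; group
        rw [e5] at h2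
        have := tlen_of_mul (z * a ^ (k * r)) g''
        change tlen (HNNExtension.of _ * g'') = _ at h2
        omega
  · exact absurd (eq_zero_of_conj_eq_b_zpow (g := z) (i := i) (n := n)
      (by rw [← h3]; group)).2 hn

theorem exists_conj_a_zpow_of_brunnerRel (hlm : |m| < |l|) {l₁ m₁ k₁ : ℤ} (h₁ : |m₁| < |l₁|)
    {z : BaumslagSolitar l m} {τ : BrunnerHNN l m k} (h : BrunnerRel l₁ m₁ k₁ (of z) τ) :
    ∃ (g : BrunnerHNN l m k) (d : ℤ), of z * g = g * of (a ^ d) := by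
  have hl₁ : l₁ ≠ 0 := by rintro rfl; simp at h₁; linarith [abs_nonneg m₁]
  have base : ∀ {x : BaumslagSolitar l m} {p q : ℤ}, |q| < |p| → z ^ p * x = x * z ^ q →
      ∃ g d, (of z * g : BrunnerHNN l m k) = g * of (a ^ (d : ℤ)) := by
    intro x p q hpq hx
    obtain ⟨y, d, hy⟩ := exists_conj_a_zpow hpq hx
    exact ⟨of y, d, by rw [← map_mul, hy, map_mul]⟩
  have h' := h.mul_eq
  set β := τ⁻¹ * of z ^ k₁ * τ
  rw [← map_zpow, ← map_zpow] at h'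
  by_cases h0 : tlen β = 0
  · obtain ⟨x, hx⟩ := tlen_eq_zero.1 h0
    have h2 : of (z ^ l₁ * x) = (of (x * z ^ m₁) : BrunnerHNN l m k) := by
      rw [map_mul, map_mul]
      change _ * HNNExtension.of x = HNNExtension.of x * _
      rw [hx, h']
    exact base h₁ (of_injective h2)
  · rcases CyclicHNN.exists_pinch h0 h' with ⟨w, i, -, -, -, h3, -⟩ | ⟨w, i, -, -, -, h3, -⟩
    · refine base (p := l₁ * l) (q := l₁ * m) (x := w * b * w⁻¹) ?_ ?_
      · rw [abs_mul, abs_mul]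
        exact mul_lt_mul_of_pos_left hlm (abs_pos.2 hl₁)
      · have h4 : z ^ l₁ = w * a ^ (k * i) * w⁻¹ := by rw [zpow_mul, ← h3]; group
        rw [zpow_mul, zpow_mul, h4, conj_zpow, conj_zpow, ← zpow_mul, ← zpow_mul]
        have := rel_zpow (l := l) (m := m) (k * i)
        calc _ = w * (a ^ (l * (k * i)) * b) * w⁻¹ := by rw [mul_comm l]; group
          _ = _ := by rw [← this, mul_comm m]; group
    · by_cases hi : i = 0
      · refine base (p := l₁) (q := 0) (x := 1) (by simpa using hl₁) ?_
        have h4 : z ^ l₁ = w * b ^ i * w⁻¹ := by rw [← h3]; group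
        simp [h4, hi]
      · have h4 : b ^ i = (w⁻¹ * z * w) ^ l₁ := by
          have := conj_zpow (i := l₁) (a := w⁻¹) (b := z)
          rw [inv_inv] at this
          rw [this, h3]
        obtain ⟨r, hr⟩ := exists_eq_b_zpow_of_conj hlm (g := w⁻¹ * z * w) hi
          (j := i) (by rw [h4, ← zpow_add_one, ← zpow_one_add, add_comm])
        refine ⟨of w * t⁻¹, k * r, ?_⟩
        have h5 : z = w * b ^ r * w⁻¹ := by rw [← hr]; group
        have := t_mul_b_zpow (l := l) (m := m) (k := k) r
        calc _ = of w * t⁻¹ * (t * of (b ^ r)) * t⁻¹ := by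
              rw [h5, map_mul, map_mul, map_inv]; group
          _ = _ := by rw [this]; group

theorem exists_conj_a_zpow_of_brunnerRel_of_closure (hlm : |m| < |l|) {l₁ m₁ k₁ : ℤ}
    (h₁ : |m₁| < |l₁|)
    (hm₁ : m₁ ≠ 0) {α τ : BrunnerHNN l m k} (h : BrunnerRel l₁ m₁ k₁ α τ) (hk₁ : k₁ ≠ 0)
    (hne : α ≠ 1) (hτ : tExp τ ≠ 1) :
    ∃ d i : ℤ, (∃ g, α * g = g * of (a ^ d)) ∧
      (∃ x : BaumslagSolitar l m, a ^ (d * k₁) * x = x * a ^ (k * i)) ∧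
      (l₁ : ℚ) = (l / m : ℚ) ^ i * m₁ := by
  have hl₁ : l₁ ≠ 0 := by rintro rfl; simp at h₁; linarith [abs_nonneg m₁]
  obtain ⟨y, z, hy⟩ := exists_conj_of_of_zpow_conj h₁ h.mul_eq
  have hz : MulAut.conj y⁻¹ α = of z := by
    rw [MulAut.conj_apply, inv_inv, mul_assoc, hy]
    simp [of]
  have h2 := h.map (MulAut.conj y⁻¹).toMonoidHom
  change BrunnerRel l₁ m₁ k₁ (MulAut.conj y⁻¹ α) _ at h2
  rw [hz] at h2
  obtain ⟨g, d, hg⟩ := exists_conj_a_zpow_of_brunnerRel hlm h₁ h2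
  have hα : α * (y * g) = y * g * of (a ^ d) := by
    rw [← mul_assoc, hy, mul_assoc y _ g]
    change y * (of z * g) = _
    rw [hg, mul_assoc]
  set w := y * g
  have hd : d ≠ 0 := by
    rintro rfl
    apply hne
    simpa using hα
  have h3 := h.map (MulAut.conj w⁻¹).toMonoidHom
  change BrunnerRel l₁ m₁ k₁ (MulAut.conj w⁻¹ α) (MulAut.conj w⁻¹ τ) at h3
  have hz' : MulAut.conj w⁻¹ α = of (a ^ d) := by
    rw [MulAut.conj_apply, inv_inv, mul_assoc, hα]
    group
  rw [hz'] at h3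
  have hτ' : tExp (MulAut.conj w⁻¹ τ) ≠ 1 := by
    simpa [MulAut.conj_apply] using hτ
  set τ' := MulAut.conj w⁻¹ τ
  have h4 := h3.mul_eq
  have hβ : of (a ^ (d * k₁)) * τ' = τ' * (τ'⁻¹ * of (a ^ d) ^ k₁ * τ') := by
    rw [zpow_mul, map_zpow of (a ^ d)]
    group
  set β := τ'⁻¹ * of (a ^ d) ^ k₁ * τ'
  rw [← map_zpow, ← zpow_mul, ← map_zpow, ← zpow_mul] at h4
  rcases of_or_of_conj hlm (mul_ne_zero hd hl₁) h4 with ⟨β', hβ'⟩ | ⟨x, x', i, -, h5, h6⟩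
  · rw [hβ'] at hβ h4
    rcases of_or_of_conj hlm (mul_ne_zero hd hk₁) hβ with ⟨x, hx⟩ | ⟨x, x', i, -, h5, h6⟩
    · rw [hx] at hτ'
      simp at hτ'
    · refine ⟨d, i, ⟨w, hα⟩, ⟨x, h5⟩, ?_⟩
      rw [← map_mul, ← map_mul] at h4
      have h7 := eq_mul_zpow_of_conj (of_injective h4)
      have h8 : (bExp β').toAdd = i := by
        have := congrArg (fun w => (bExp w).toAdd) h6
        simp at this
        omega
      rw [h8] at h7
      have hdq : (d : ℚ) ≠ 0 := by exact_mod_cast hd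
      push_cast at h7
      refine mul_left_cancel₀ hdq ?_
      rw [h7]
      ring
  · exact absurd (eq_zero_of_conj_eq_b_zpow (g := x'⁻¹) (i := i) (n := d * m₁)
      (by rw [eq_mul_inv_iff_mul_eq.2 h6]; group)).2 (mul_ne_zero hd hm₁)

end BrunnerHNN

namespace BrunnerGroup

/-- The class of an element in the abelianization, after killing `t`. -/
def toZMod (l m k : ℤ) : BrunnerGroup l m k →* Multiplicative (ZMod (l - m).natAbs) :=
  lift (Multiplicative.ofAdd 1) 1 (by
    have h : ((l - m : ℤ) : ZMod (l - m).natAbs) = 0 :=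
      (ZMod.intCast_zmod_eq_zero_iff_dvd _ _).2 (by simp)
    simp only [BrunnerRel, inv_one, one_mul, mul_one]
    rw [← ofAdd_zsmul, ← ofAdd_zsmul, ← ofAdd_zsmul, mul_comm, mul_inv_cancel_left]
    congr 1
    push_cast at h
    simpa [sub_eq_zero] using h)

theorem brunnerRel_one {K : Type*} [Group K] (l m k : ℤ) (τ : K) : BrunnerRel l m k 1 τ := by
  simp [BrunnerRel]

/-- The exponent sum of `t`. -/
def tExp (l m k : ℤ) : BrunnerGroup l m k →* Multiplicative ℤ :=
  lift 1 (Multiplicative.ofAdd 1) (brunnerRel_one _ _ _ _)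

theorem tExp_a (l m k : ℤ) : tExp l m k a = 1 := lift_a _ _ _

theorem toZMod_a_zpow (l m k n : ℤ) : (toZMod l m k (a ^ n)).toAdd = n := by
  rw [map_zpow, toZMod, lift_a]
  simp

theorem tExp_a_zpow (l m k n : ℤ) : tExp l m k (a ^ n) = 1 := by
  rw [map_zpow, tExp_a, one_zpow]

theorem tExp_t (l m k : ℤ) : tExp l m k t = Multiplicative.ofAdd 1 := lift_t _ _ _

theorem map_eq_of_conj {G K : Type*} [Group G] [CommGroup K] (f : G →* K) {x y g : G}
    (h : x * g = g * y) : f x = f y := by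
  have := congrArg f h
  rw [map_mul, map_mul, mul_comm] at this
  exact mul_left_cancel this

/-- Surjections between the groups `G(l,m;k)` with `|m| < |l|` map `a` to conjugates of powers
of `a` satisfying numerical conditions. -/
theorem exists_of_surjective {l m k l₁ m₁ k₁ : ℤ} [NeZero l] [NeZero m] [NeZero k]
    (hlm : |m| < |l|) (h₁ : |m₁| < |l₁|) (hm₁ : m₁ ≠ 0) (hk₁ : k₁ ≠ 0)
    {f : BrunnerGroup l₁ m₁ k₁ →* BrunnerGroup l m k} (hf : Function.Surjective f) :
    ∃ d i : ℤ, (∃ g, f a * g = g * a ^ d) ∧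
      (∃ x : BaumslagSolitar l m, BaumslagSolitar.a ^ (d * k₁) * x =
        x * BaumslagSolitar.a ^ (k * i)) ∧
      (l₁ : ℚ) = (l / m : ℚ) ^ i * m₁ ∧ IsCoprime d (l - m) ∧ l - m ∣ l₁ - m₁ := by
  have hclosure : ∀ P : BrunnerGroup l m k → Prop, P (f a) → P (f t) →
      (∀ x y, P x → P y → P (x * y)) → (∀ x, P x → P x⁻¹) → ∀ g, P g := by
    intro P ha ht hmul hinv g
    have h1 : P 1 := by simpa using hmul _ _ ha (hinv _ ha)
    let S : Subgroup (BrunnerGroup l₁ m₁ k₁) :=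
      { carrier := {x | P (f x)}
        mul_mem' := fun hx hy => by
          rw [Set.mem_ofPred_eq, map_mul]; exact hmul _ _ hx hy
        one_mem' := by rw [Set.mem_ofPred_eq, map_one]; exact h1
        inv_mem' := fun hx => by
          rw [Set.mem_ofPred_eq, map_inv]; exact hinv _ hx }
    obtain ⟨x, rfl⟩ := hf g
    have : x ∈ S := (eq_top_of_mem (S := S) ha ht) ▸ Subgroup.mem_top x
    exact this
  have hrel : BrunnerRel l₁ m₁ k₁ (f a) (f t) := rel.map f
  -- the exponent sum of `t` vanishes on `f a`
  have hta : tExp l m k (f a) = 1 := by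
    have := (hrel.map (tExp l m k)).mul_eq
    rw [mul_comm] at this
    have h2 := congrArg Multiplicative.toAdd (mul_left_cancel this)
    simp only [toAdd_zpow, smul_eq_mul] at h2
    have h3 : l₁ ≠ m₁ := by rintro rfl; exact lt_irrefl _ h₁
    have h4 : (Multiplicative.toAdd (tExp l m k (f a))) = 0 := by
      by_contra h5
      exact h3 (mul_right_cancel₀ h5 h2)
    exact Multiplicative.toAdd.injective h4
  have htt : tExp l m k (f t) ≠ 1 := by
    intro h1
    have := hclosure (fun g => tExp l m k g = 1) hta h1
      (fun x y hx hy => by simp [hx, hy]) (fun x hx => by simp [hx]) t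
    rw [tExp_t] at this
    exact absurd (congrArg Multiplicative.toAdd this) (by simp)
  have htE : ∀ g : BrunnerGroup l m k, BrunnerHNN.tExp (BrunnerHNN.equiv g) = tExp l m k g := by
    have : (BrunnerHNN.tExp.comp BrunnerHNN.equiv.toMonoidHom :
        BrunnerGroup l m k →* _) = tExp l m k :=
      hom_ext (by simp [BrunnerHNN.equiv_a, tExp_a]) (by simp [BrunnerHNN.equiv_t, tExp_t])
    exact DFunLike.congr_fun this
  have hne : f a ≠ 1 := by
    intro h1
    have h2 := hclosure (fun g => ∃ n : ℤ, g = f t ^ n) ⟨0, by simpa using h1⟩ ⟨1, by simp⟩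
      (fun x y ⟨i, hi⟩ ⟨j, hj⟩ => ⟨i + j, by rw [hi, hj, zpow_add]⟩)
      (fun x ⟨i, hi⟩ => ⟨-i, by rw [hi, zpow_neg]⟩) a
    obtain ⟨n, hn⟩ := h2
    have h3 := congrArg (fun g => (tExp l m k g).toAdd) hn
    have h4 := tExp_a_zpow l m k 1
    rw [zpow_one] at h4
    simp only [h4, map_zpow, toAdd_one, toAdd_zpow, smul_eq_mul, zero_eq_mul] at h3
    rcases h3 with h3 | h3
    · rw [h3, zpow_zero] at hn
      have h5 := congrArg BrunnerHNN.equiv hn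
      rw [BrunnerHNN.equiv_a, map_one, ← map_one BrunnerHNN.of] at h5
      have h6 := BrunnerHNN.of_injective h5
      have := BaumslagSolitar.a_zpow_injective (l := l) (m := m) (a₁ := 1) (a₂ := 0)
        (by simpa using h6)
      omega
    · exact htt (Multiplicative.toAdd.injective h3)
  have hrel' := hrel.map (BrunnerHNN.equiv (l := l) (m := m) (k := k)).toMonoidHom
  obtain ⟨d, i, ⟨g, hg⟩, hx, hi⟩ :=
    BrunnerHNN.exists_conj_a_zpow_of_brunnerRel_of_closure hlm h₁ hm₁ hrel' hk₁
    (by simpa using hne) (by rw [← htE] at htt; exact htt)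
  have hg' : f a * BrunnerHNN.equiv.symm g = BrunnerHNN.equiv.symm g * a ^ d := by
    apply BrunnerHNN.equiv.injective
    rw [map_mul, map_mul, MulEquiv.apply_symm_apply, map_zpow, BrunnerHNN.equiv_a, ← map_zpow]
    exact hg
  have hza : (toZMod l m k (f a)).toAdd = d := by
    rw [map_eq_of_conj (toZMod l m k) hg', toZMod_a_zpow]
  have hcop : IsCoprime d (l - m) := by
    have h2 := hclosure (fun g => ∃ i j : ℤ, (toZMod l m k g).toAdd =
      i * d + j * (toZMod l m k (f t)).toAdd ∧
      (tExp l m k g).toAdd = j * (tExp l m k (f t)).toAdd)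
      ⟨1, 0, by simp [hza], by simp [hta]⟩ ⟨0, 1, by simp, by simp⟩
      (fun x y ⟨i, j, h1, h2⟩ ⟨i', j', h1', h2'⟩ => ⟨i + i', j + j', by
        simp only [map_mul, toAdd_mul, h1, h1']; push_cast; ring, by
        simp only [map_mul, toAdd_mul, h2, h2']; ring⟩)
      (fun x ⟨i, j, h1, h2⟩ => ⟨-i, -j, by
        simp only [map_inv, toAdd_inv, h1]; push_cast; ring, by
        simp only [map_inv, toAdd_inv, h2]; ring⟩) a
    obtain ⟨i, j, h3, h4⟩ := h2
    have h5 := tExp_a_zpow l m k 1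
    have h6 := toZMod_a_zpow l m k 1
    rw [zpow_one] at h5 h6
    rw [h5, toAdd_one, zero_eq_mul] at h4
    rcases h4 with rfl | h4
    · rw [h6] at h3
      have h7 : ((1 - i * d : ℤ) : ZMod (l - m).natAbs) = 0 := by
        push_cast at h3 ⊢
        rw [h3]
        simp
      rw [ZMod.intCast_zmod_eq_zero_iff_dvd, Int.natAbs_dvd] at h7
      obtain ⟨c, hc⟩ := h7
      exact ⟨i, c, by linarith⟩
    · exact absurd (Multiplicative.toAdd.injective h4) htt
  refine ⟨d, i, ⟨_, hg'⟩, hx, hi, hcop, ?_⟩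
  have h2 := (hrel.map (toZMod l m k)).mul_eq
  rw [mul_comm] at h2
  have h3 := congrArg Multiplicative.toAdd (mul_left_cancel h2)
  simp only [toAdd_zpow, hza, zsmul_eq_mul] at h3
  have h7 : (((l₁ - m₁) * d : ℤ) : ZMod (l - m).natAbs) = 0 := by
    push_cast
    rw [sub_mul, h3, sub_self]
  rw [ZMod.intCast_zmod_eq_zero_iff_dvd, Int.natAbs_dvd] at h7
  exact hcop.symm.dvd_of_dvd_mul_right h7

end BrunnerGroup

namespace BaumslagSolitar

theorem eq_of_reflTransGen_step {l m x y : ℤ} (hml : m ∣ l) (hx : ¬ m ∣ x)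
    (h : Relation.ReflTransGen (Step l m) x y) : x = y := by
  rcases Relation.ReflTransGen.cases_head h with h | ⟨c, ⟨z, hz⟩, -⟩
  · exact h
  · refine absurd ?_ hx
    rcases hz with ⟨rfl, -⟩ | ⟨rfl, -⟩
    · exact hml.mul_right z
    · exact dvd_mul_right m z

end BaumslagSolitar

namespace BrunnerGroup

open BaumslagSolitar

theorem nonempty_mulEquiv_of_reflTransGen {l m x y : ℤ}
    (h : Relation.ReflTransGen (Step l m) x y) :
    Nonempty (BrunnerGroup l m x ≃* BrunnerGroup l m y) := by
  induction h with
  | refl => exact ⟨MulEquiv.refl _⟩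
  | tail _ hs ih =>
    obtain ⟨e⟩ := ih
    obtain ⟨z, ⟨rfl, rfl⟩ | ⟨rfl, rfl⟩⟩ := hs
    · obtain ⟨e'⟩ := nonempty_mulEquiv_of_step l m z
      exact ⟨e.trans e'⟩
    · obtain ⟨e'⟩ := nonempty_mulEquiv_of_step l m z
      exact ⟨e.trans e'.symm⟩

theorem nonempty_mulEquiv_of_natAbs_eq (l m : ℤ) {x y : ℤ} (h : x.natAbs = y.natAbs) :
    Nonempty (BrunnerGroup l m x ≃* BrunnerGroup l m y) := by
  rcases Int.natAbs_eq_natAbs_iff.1 h with rfl | rfl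
  · exact ⟨MulEquiv.refl _⟩
  · obtain ⟨e⟩ := nonempty_mulEquiv_neg l m y
    exact ⟨e.symm⟩

theorem nonempty_mulEquiv_pow_mul (m q κ : ℤ) (e : ℕ) :
    Nonempty (BrunnerGroup (m * q) m (q ^ e * (m * κ)) ≃* BrunnerGroup (m * q) m (m * κ)) := by
  induction e with
  | zero => rw [pow_zero, one_mul]; exact ⟨MulEquiv.refl _⟩
  | succ e ih =>
    obtain ⟨f⟩ := ih
    obtain ⟨f'⟩ := nonempty_mulEquiv_of_step (m * q) m (q ^ e * κ)
    have h1 : q ^ (e + 1) * (m * κ) = m * q * (q ^ e * κ) := by ring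
    have h2 : q ^ e * (m * κ) = m * (q ^ e * κ) := by ring
    rw [h1]
    rw [h2] at f
    exact ⟨f'.trans f⟩

theorem abs_zpow_eq_self {r : ℚ} (hr : 1 < |r|) {n : ℤ} (h : |r| ^ n = |r|) : n = 1 := by
  have : |r| ^ n = |r| ^ (1 : ℤ) := by rw [h, zpow_one]
  exact zpow_right_injective₀ (by linarith) (by linarith) this

/-- Groups `G(l,m;k)` with `m < |l|` which are images of each other have the same `l` and `m`. -/
theorem parameters_eq {l₁ m₁ l₂ m₂ i i' : ℤ} (hm₁ : 0 < m₁) (hm₂ : 0 < m₂)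
    (h₁ : |m₁| < |l₁|) (h₂ : |m₂| < |l₂|)
    (h : (l₁ : ℚ) = (l₂ / m₂ : ℚ) ^ i * m₁) (h' : (l₂ : ℚ) = (l₁ / m₁ : ℚ) ^ i' * m₂)
    (hd : l₂ - m₂ ∣ l₁ - m₁) (hd' : l₁ - m₁ ∣ l₂ - m₂) :
    l₁ = l₂ ∧ m₁ = m₂ ∧ i = 1 ∧ i' = 1 := by
  have : NeZero m₁ := ⟨hm₁.ne'⟩
  have : NeZero m₂ := ⟨hm₂.ne'⟩
  have hr₁ := one_lt_abs_div h₁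
  have hr₂ := one_lt_abs_div h₂
  have q₁ : (m₁ : ℚ) ≠ 0 := by exact_mod_cast hm₁.ne'
  have q₂ : (m₂ : ℚ) ≠ 0 := by exact_mod_cast hm₂.ne'
  have e₁ : (l₁ / m₁ : ℚ) = (l₂ / m₂ : ℚ) ^ i := by rw [h]; field_simp
  have e₂ : (l₂ / m₂ : ℚ) = (l₁ / m₁ : ℚ) ^ i' := by rw [h']; field_simp
  have hii : i * i' = 1 := by
    refine abs_zpow_eq_self hr₂ ?_
    rw [zpow_mul, ← abs_zpow, ← e₁, ← abs_zpow, ← e₂]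
  have hi : i = 1 := by
    rcases Int.eq_one_or_neg_one_of_mul_eq_one hii with hi | hi
    · exact hi
    · exfalso
      rw [hi, zpow_neg_one] at e₁
      rw [e₁, abs_inv] at hr₁
      have := inv_lt_one_of_one_lt₀ hr₂
      linarith
  have hi' : i' = 1 := by rw [hi, one_mul] at hii; exact hii
  rw [hi, zpow_one] at e₁
  have hc : l₁ * m₂ = l₂ * m₁ := by
    rw [div_eq_div_iff q₁ q₂] at e₁
    exact_mod_cast e₁
  have hne : l₂ - m₂ ≠ 0 := by
    intro h0
    rw [sub_eq_zero.1 h0] at h₂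
    exact lt_irrefl _ h₂
  have hm : m₁ = m₂ := by
    have h3 : (l₁ - m₁) * m₂ = (l₂ - m₂) * m₁ := by linarith
    rcases Int.natAbs_eq_natAbs_iff.1 (Nat.dvd_antisymm (Int.natAbs_dvd_natAbs.2 hd)
      (Int.natAbs_dvd_natAbs.2 hd')) with h4 | h4
    · rw [← h4] at h3
      exact (mul_left_cancel₀ hne h3).symm
    · have h5 : l₁ - m₁ = -(l₂ - m₂) := by omega
      rw [h5, neg_mul, ← mul_neg] at h3
      have := mul_left_cancel₀ hne h3
      omega
  subst hm
  exact ⟨mul_right_cancel₀ hm₂.ne' hc, rfl, hi, hi'⟩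

theorem exists_pow_of_mul_eq {l m k₁ k₂ d d' s s' : ℤ} (hm : 0 < m) (hlm : |m| < |l|)
    (hk₁ : 0 < k₁) (hk₂ : 0 < k₂) (h : ((d * k₁ : ℤ) : ℚ) = (l / m : ℚ) ^ s * k₂)
    (h' : ((d' * k₂ : ℤ) : ℚ) = (l / m : ℚ) ^ s' * k₁) :
    d * d' = 1 ∨ ∃ q : ℤ, ∃ S : ℕ, l = m * q ∧ 1 < |q| ∧ S ≠ 0 ∧ d * d' = q ^ S := by
  have : NeZero m := ⟨hm.ne'⟩
  have hr := one_lt_abs_div hlm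
  have hr0 : (l / m : ℚ) ≠ 0 := by
    intro h0
    rw [h0] at hr
    simp at hr
    linarith
  have e₁ : (k₁ : ℚ) ≠ 0 := by exact_mod_cast hk₁.ne'
  have e₂ : (k₂ : ℚ) ≠ 0 := by exact_mod_cast hk₂.ne'
  have em : (m : ℚ) ≠ 0 := by exact_mod_cast hm.ne'
  have key : ((d * d' : ℤ) : ℚ) = (l / m : ℚ) ^ (s + s') := by
    rw [zpow_add₀ hr0]
    push_cast at h h' ⊢
    have : (d * d' : ℚ) * (k₁ * k₂) = (l / m : ℚ) ^ s * (l / m : ℚ) ^ s' * (k₁ * k₂) := by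
      linear_combination d' * k₂ * h + (l / m : ℚ) ^ s * k₂ * h'
    exact mul_right_cancel₀ (mul_ne_zero e₁ e₂) this
  have hne : d * d' ≠ 0 := by
    intro h0
    rw [h0] at key
    exact zpow_ne_zero _ hr0 (by simpa using key.symm)
  rcases lt_trichotomy (s + s') 0 with hS | hS | hS
  · exfalso
    have h1 : (1 : ℚ) ≤ |((d * d' : ℤ) : ℚ)| := by exact_mod_cast Int.one_le_abs hne
    rw [key, abs_zpow] at h1
    have := zpow_lt_one_of_neg₀ hr hS
    linarith
  · left
    rw [hS, zpow_zero] at key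
    exact_mod_cast key
  · right
    obtain ⟨S, hS'⟩ := Int.eq_ofNat_of_zero_le hS.le
    have hS0 : S ≠ 0 := by omega
    rw [hS', zpow_natCast, div_pow, eq_div_iff (pow_ne_zero _ em)] at key
    have key' : d * d' * m ^ S = l ^ S := by exact_mod_cast key
    have hml : m ∣ l := (Int.pow_dvd_pow_iff hS0).1 ⟨d * d', by rw [← key']; ring⟩
    obtain ⟨q, rfl⟩ := hml
    refine ⟨q, S, rfl, ?_, hS0, ?_⟩
    · rw [abs_mul] at hlm
      exact (lt_mul_iff_one_lt_right (abs_pos.2 hm.ne')).1 hlm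
    · rw [mul_pow, mul_comm] at key'
      exact mul_left_cancel₀ (pow_ne_zero S hm.ne') key'

theorem lower_bounds {m q k₁ k₂ d d' : ℤ} {S : ℕ} (hm : 0 < m) (hq : 1 < |q|) (hS : S ≠ 0)
    (hk₁ : 0 < k₁) (hk₂ : 0 < k₂) (hdd : d * d' = q ^ S)
    (hd : IsCoprime d (m * q - m)) (hd' : IsCoprime d' (m * q - m))
    (h : Relation.ReflTransGen (Step (m * q) m) (d * k₁) k₂)
    (h' : Relation.ReflTransGen (Step (m * q) m) (d' * k₂) k₁) {s : ℤ}
    (hs : ((d * k₁ : ℤ) : ℚ) = (q : ℚ) ^ s * k₂)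
    (hiso : ¬ Nonempty (BrunnerGroup (m * q) m k₁ ≃* BrunnerGroup (m * q) m k₂)) :
    2 ≤ m ∧ (m = 2 → 18 ≤ |m * q|) ∧ 2 ≤ min k₁ k₂ ∧ 6 ≤ max k₁ k₂ := by
  have hmq : m * q - m = m * (q - 1) := by ring
  rw [hmq] at hd hd'
  replace hd := hd.of_mul_right_left
  replace hd' := hd'.of_mul_right_left
  have hm2 : 2 ≤ m := by
    by_contra hlt
    obtain rfl : m = 1 := by omega
    apply hiso
    rw [one_mul] at h ⊢
    obtain ⟨e⟩ := nonempty_mulEquiv_of_dvd_pow (S := S) ⟨d', hdd.symm⟩ k₁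
    obtain ⟨e'⟩ := nonempty_mulEquiv_of_reflTransGen h
    exact ⟨e.trans e'⟩
  have hpow : 1 < |q ^ S| := by
    rw [abs_pow]
    exact one_lt_pow₀ hq hS
  have hne1 : d * d' ≠ 1 := by
    intro h1
    rw [← hdd, h1] at hpow
    simp at hpow
  have hk : m ∣ k₁ ∧ m ∣ k₂ := by
    by_contra hnot
    have step1 : ¬ m ∣ k₁ → d * k₁ = k₂ := fun hn =>
      eq_of_reflTransGen_step (dvd_mul_right m q) (fun hc => hn (hd.symm.dvd_of_dvd_mul_left hc)) h
    have step2 : ¬ m ∣ k₂ → d' * k₂ = k₁ := fun hn =>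
      eq_of_reflTransGen_step (dvd_mul_right m q)
        (fun hc => hn (hd'.symm.dvd_of_dvd_mul_left hc)) h'
    have hn1 : ¬ m ∣ k₁ := by
      intro h1
      have h2 : ¬ m ∣ k₂ := fun h2 => hnot ⟨h1, h2⟩
      rw [← step2 h2] at h1
      exact h2 (hd'.symm.dvd_of_dvd_mul_left h1)
    have e1 := step1 hn1
    have hn2 : ¬ m ∣ k₂ := by
      rw [← e1]
      exact fun hc => hn1 (hd.symm.dvd_of_dvd_mul_left hc)
    have e2 := step2 hn2
    rw [← e1] at e2
    apply hne1
    have : d * d' * k₁ = 1 * k₁ := by linarith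
    exact mul_right_cancel₀ hk₁.ne' this
  obtain ⟨⟨x, rfl⟩, ⟨y, rfl⟩⟩ := hk
  have hx : 0 < x := pos_of_mul_pos_right hk₁ hm.le
  have hy : 0 < y := pos_of_mul_pos_right hk₂ hm.le
  have hxy : x ≠ y := by
    rintro rfl
    exact hiso ⟨MulEquiv.refl _⟩
  have hodd : m = 2 → Odd q ∧ (Even x ↔ Even y) := by
    rintro rfl
    have o1 : Odd d := by
      rw [← Int.not_even_iff_odd, even_iff_two_dvd]
      intro hc
      have := hd.symm.isUnit_of_dvd' (dvd_refl 2) hc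
      exact absurd (Int.isUnit_iff.1 this) (by norm_num)
    have o2 : Odd d' := by
      rw [← Int.not_even_iff_odd, even_iff_two_dvd]
      intro hc
      have := hd'.symm.isUnit_of_dvd' (dvd_refl 2) hc
      exact absurd (Int.isUnit_iff.1 this) (by norm_num)
    have o3 : Odd q := by
      have := o1.mul o2
      rw [hdd, Int.odd_pow] at this
      tauto
    refine ⟨o3, ?_⟩
    have hq0 : (q : ℚ) ≠ 0 := by
      intro h0
      have : q = 0 := by exact_mod_cast h0
      rw [this] at hq
      norm_num at hq
    rcases Int.eq_nat_or_neg s with ⟨n, rfl | rfl⟩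
    · rw [zpow_natCast] at hs
      have hs' : d * (2 * x) = q ^ n * (2 * y) := by exact_mod_cast hs
      have hs2 : d * x = q ^ n * y := by linarith
      have o4 : Odd (q ^ n) := o3.pow
      have := congrArg Even hs2
      rw [Int.even_mul, Int.even_mul] at this
      rw [← Int.not_even_iff_odd] at o1 o4
      simpa [o1, o4] using this
    · rw [zpow_neg, zpow_natCast, ← div_eq_inv_mul, eq_div_iff (pow_ne_zero _ hq0)] at hs
      have hs' : d * (2 * x) * q ^ n = 2 * y := by exact_mod_cast hs
      have hs2 : d * q ^ n * x = y := by linarith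
      have o4 : Odd (d * q ^ n) := o1.mul o3.pow
      rw [← hs2, Int.even_mul]
      rw [← Int.not_even_iff_odd] at o4
      simp [o4]
  refine ⟨hm2, ?_, ?_, ?_⟩
  · rintro rfl
    obtain ⟨o, -⟩ := hodd rfl
    by_contra hlt
    have hq9 : |q| < 9 := by
      rw [abs_mul] at hlt
      norm_num at hlt
      omega
    have hp : q.natAbs.Prime := by
      have h1 : 1 < q.natAbs := by rw [Int.abs_eq_natAbs] at hq; omega
      have h2 : q.natAbs < 9 := by rw [Int.abs_eq_natAbs] at hq9; omega
      have h3 : Odd q.natAbs := Int.natAbs_odd.2 o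
      generalize q.natAbs = p at h1 h2 h3
      interval_cases p <;> first | (exfalso; revert h3; decide) | norm_num
    have hdvd : d.natAbs ∣ q.natAbs ^ S := by
      rw [← Int.natAbs_pow, Int.natAbs_dvd_natAbs]
      exact ⟨d', hdd.symm⟩
    obtain ⟨e, -, he⟩ := (Nat.dvd_prime_pow hp).1 hdvd
    apply hiso
    obtain ⟨f₁⟩ := nonempty_mulEquiv_pow_mul 2 q x e
    obtain ⟨f₂⟩ := nonempty_mulEquiv_of_natAbs_eq (2 * q) 2 (x := q ^ e * (2 * x))
      (y := d * (2 * x)) (by rw [Int.natAbs_mul, Int.natAbs_mul d, he, Int.natAbs_pow])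
    obtain ⟨f₃⟩ := nonempty_mulEquiv_of_reflTransGen h
    exact ⟨f₁.symm.trans (f₂.trans f₃)⟩
  · refine le_min ?_ ?_ <;> nlinarith
  · rcases eq_or_lt_of_le hm2 with h2 | h2
    · obtain ⟨-, hp⟩ := hodd h2.symm
      subst h2
      rw [Int.even_iff, Int.even_iff] at hp
      rw [le_max_iff]
      omega
    · rw [le_max_iff]
      rcases lt_or_gt_of_ne hxy with h3 | h3
      · right; nlinarith
      · left; nlinarith

/-- The bounds on the parameters when `m < |l|` for both groups. -/
theorem lower_bounds_of_mutualImages {l₁ m₁ k₁ l₂ m₂ k₂ : ℤ} (hm₁ : 0 < m₁) (hm₂ : 0 < m₂)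
    (h₁ : m₁ < |l₁|) (h₂ : m₂ < |l₂|) (hk₁ : 0 < k₁) (hk₂ : 0 < k₂)
    (h : MutualImagesNotIsomorphic (BrunnerGroup l₁ m₁ k₁) (BrunnerGroup l₂ m₂ k₂)) :
    (2 ≤ m₁ ∧ 2 ≤ m₂) ∧ (m₁ = 2 → 18 ≤ |l₁|) ∧ (m₂ = 2 → 18 ≤ |l₂|) ∧
      2 ≤ min k₁ k₂ ∧ 6 ≤ max k₁ k₂ := by
  rw [← abs_of_pos hm₁] at h₁
  rw [← abs_of_pos hm₂] at h₂
  have : NeZero m₁ := ⟨hm₁.ne'⟩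
  have : NeZero m₂ := ⟨hm₂.ne'⟩
  have : NeZero l₁ := ⟨by rintro rfl; simp at h₁; linarith [abs_nonneg m₁]⟩
  have : NeZero l₂ := ⟨by rintro rfl; simp at h₂; linarith [abs_nonneg m₂]⟩
  have : NeZero k₁ := ⟨hk₁.ne'⟩
  have : NeZero k₂ := ⟨hk₂.ne'⟩
  obtain ⟨⟨g, hg⟩, ⟨f, hf⟩, hiso⟩ := h
  obtain ⟨d, i, -, ⟨x, hx⟩, hi, hcop, hdvd⟩ := exists_of_surjective h₂ h₁ hm₁.ne' hk₁.ne' hf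
  obtain ⟨d', i', -, ⟨x', hx'⟩, hi', hcop', hdvd'⟩ :=
    exists_of_surjective h₁ h₂ hm₂.ne' hk₂.ne' hg
  obtain ⟨rfl, rfl, rfl, rfl⟩ := parameters_eq hm₁ hm₂ h₁ h₂ hi hi' hdvd hdvd'
  rw [mul_one] at hx hx'
  have hs := eq_mul_zpow_of_conj hx
  have hs' := eq_mul_zpow_of_conj hx'
  have hc := reflTransGen_step_of_conj hx
  have hc' := reflTransGen_step_of_conj hx'
  rcases exists_pow_of_mul_eq hm₁ h₁ hk₁ hk₂ hs hs' with h1 | ⟨q, S, rfl, hq, hS, hdd⟩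
  · exfalso
    apply hiso
    obtain ⟨e⟩ := nonempty_mulEquiv_of_reflTransGen hc
    have : d.natAbs = 1 := by
      rcases Int.eq_one_or_neg_one_of_mul_eq_one h1 with rfl | rfl <;> rfl
    obtain ⟨e'⟩ := nonempty_mulEquiv_of_natAbs_eq l₁ m₁ (x := k₁) (y := d * k₁)
      (by rw [Int.natAbs_mul, this, one_mul])
    exact ⟨e'.trans e⟩
  · have hqm : (((m₁ * q : ℤ) : ℚ) / m₁) = q := by
      have : (m₁ : ℚ) ≠ 0 := by exact_mod_cast hm₁.ne'
      push_cast
      field_simp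
    rw [hqm] at hs
    obtain ⟨b1, b2, b3⟩ := lower_bounds hm₁ hq hS hk₁ hk₂ hdd hcop hcop' hc hc' hs hiso
    exact ⟨⟨b1, b1⟩, b2, b2, b3⟩

theorem not_nonempty_mulEquiv_example :
    ¬ Nonempty (BrunnerGroup 18 2 2 ≃* BrunnerGroup 18 2 6) := by
  rintro ⟨e⟩
  have hlt : |(2 : ℤ)| < |18| := by norm_num
  obtain ⟨d, i, ⟨g, hg⟩, ⟨x, hx⟩, hi, -, -⟩ := exists_of_surjective hlt hlt (by norm_num)
    (by norm_num) (f := e.toMonoidHom) e.surjective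
  obtain ⟨d', i', ⟨g', hg'⟩, -⟩ := exists_of_surjective hlt hlt (by norm_num)
    (by norm_num) (f := e.symm.toMonoidHom) e.symm.surjective
  have hi1 : i = 1 := by
    have h1 : (9 : ℚ) ^ i = 9 ^ (1 : ℤ) := by
      norm_num at hi ⊢
      linarith
    exact zpow_right_injective₀ (by norm_num) (by norm_num) h1
  subst hi1
  have hd : d.natAbs ≠ 1 := by
    intro h1
    have hs := eq_mul_zpow_of_conj hx
    generalize (Multiplicative.toAdd (bExp x)) = s at hs
    have h2 : |(d : ℚ)| = 3 ^ (2 * s + 1) := by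
      have h3 : (d : ℚ) = 3 ^ (2 * s + 1) := by
        rw [zpow_add₀ (by norm_num), zpow_mul]
        push_cast at hs
        norm_num at hs ⊢
        linarith
      rw [h3, abs_of_pos (by positivity)]
    have h3 : |(d : ℚ)| = 1 := by
      rw [← Int.cast_abs, Int.abs_eq_natAbs, h1]
      norm_num
    have h4 : (3 : ℚ) ^ (2 * s + 1) = 3 ^ (0 : ℤ) := by rw [← h2, h3, zpow_zero]
    have := zpow_right_injective₀ (by norm_num) (by norm_num) h4
    omega
  have hw : a * (e.symm g * g' ) = e.symm g * g' * a ^ (d' * d) := by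
    have h1 := congrArg e.symm hg
    rw [map_mul, map_mul, map_zpow] at h1
    change e.symm (e a) * _ = _ at h1
    rw [MulEquiv.symm_apply_apply] at h1
    change e.symm a * g' = _ at hg'
    have h2 : (e.symm a) ^ d * g' = g' * a ^ (d' * d) := by
      have h3 : e.symm a = g' * a ^ d' * g'⁻¹ := by rw [← hg']; group
      rw [h3, conj_zpow, zpow_mul]
      group
    rw [← mul_assoc, h1, mul_assoc, h2, mul_assoc]
  have hw' := congrArg BrunnerHNN.equiv hw
  simp only [map_mul, map_zpow, BrunnerHNN.equiv_a] at hw'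
  generalize BrunnerHNN.equiv (e.symm g) * BrunnerHNN.equiv g' = w at hw'
  rw [← map_zpow] at hw'
  have hw1 : (BrunnerHNN.of (BaumslagSolitar.a ^ (1 : ℤ)) : BrunnerHNN 18 2 2) * w =
      w * BrunnerHNN.of (BaumslagSolitar.a ^ (d' * d)) := by
    rw [map_zpow, zpow_one]
    exact hw'
  have hnd : ¬ (2 : ℤ) ∣ 1 := by norm_num
  have hdv : (2 : ℤ) ∣ 18 := by norm_num
  rcases BrunnerHNN.of_or_of_conj hlt (n := 1) one_ne_zero hw1 with
    ⟨y, rfl⟩ | ⟨y, y', j, -, h1, -⟩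
  · rw [← map_mul, ← map_mul] at hw1
    have h2 : 1 = d' * d := eq_of_reflTransGen_step hdv hnd
      (reflTransGen_step_of_conj (BrunnerHNN.of_injective hw1))
    apply hd
    rw [mul_comm] at h2
    rcases Int.eq_one_or_neg_one_of_mul_eq_one h2.symm with rfl | rfl <;> rfl
  · have h2 := eq_of_reflTransGen_step hdv hnd (reflTransGen_step_of_conj h1)
    omega

theorem isHomomorphicImage_of_mulEquiv {G G' H : Type} [Group G] [Group G'] [Group H]
    (e : G ≃* G') (h : IsHomomorphicImage G H) : IsHomomorphicImage G' H := by
  obtain ⟨f, hf⟩ := h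
  exact ⟨e.toMonoidHom.comp f, e.surjective.comp hf⟩

theorem isHomomorphicImage_mul_three (k : ℤ) :
    IsHomomorphicImage (BrunnerGroup 18 2 (3 * k)) (BrunnerGroup 18 2 k) := by
  have r := rel (l := 18) (m := 2) (k := 3 * k)
  have h3 := r.conj_zpow 3
  have h1 := r.conj_zpow 1
  have hr : BrunnerRel 18 2 k (a ^ (3 : ℤ)) (t : BrunnerGroup 18 2 (3 * k)) := by
    rw [BrunnerRel, ← zpow_mul, ← zpow_mul, ← zpow_mul, mul_comm 3 18, h3, mul_comm 3 2]
  refine ⟨lift _ _ hr, MonoidHom.range_eq_top.1 (eq_top_of_mem ?_ ⟨t, lift_t _ _ hr⟩)⟩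
  set S := (lift _ _ hr).range
  have ht : t ∈ S := ⟨t, lift_t _ _ hr⟩
  have ha3 : a ^ (3 : ℤ) ∈ S := ⟨a, lift_a _ _ hr⟩
  have hb : t⁻¹ * a ^ (3 * k) * t ∈ S := by
    rw [zpow_mul]
    exact S.mul_mem (S.mul_mem (S.inv_mem ht) (S.zpow_mem ha3 k)) ht
  have ha18 : a ^ ((18 : ℤ) * 1) ∈ S := by
    have : (18 * 1 : ℤ) = 3 * 6 := by norm_num
    rw [this, zpow_mul]
    exact S.zpow_mem ha3 6
  have ha2 : a ^ ((2 : ℤ) * 1) ∈ S := by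
    rw [← h1]
    exact S.mul_mem (S.mul_mem (S.inv_mem hb) ha18) hb
  have : (a : BrunnerGroup 18 2 (3 * k)) = a ^ (3 : ℤ) * (a ^ ((2 : ℤ) * 1))⁻¹ := by group
  rw [this]
  exact S.mul_mem ha3 (S.inv_mem ha2)

theorem mutualImagesNotIsomorphic_example :
    MutualImagesNotIsomorphic (BrunnerGroup 18 2 2) (BrunnerGroup 18 2 6) := by
  refine ⟨?_, isHomomorphicImage_mul_three 2, not_nonempty_mulEquiv_example⟩
  obtain ⟨e⟩ := nonempty_mulEquiv_of_step 18 2 1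
  exact isHomomorphicImage_of_mulEquiv e (isHomomorphicImage_mul_three 6)

end BrunnerGroup

section FreeActions

theorem exists_orbit_coordinates {A U : Type*} [Group A] [MulAction A U]
    (hU : ∀ (a : A) (u : U), a • u = u → a = 1) :
    ∃ f : MulAction.orbitRel.Quotient A U × A ≃ U, ∀ ω a b, f (ω, b * a) = b • f (ω, a) := by
  refine ⟨Equiv.ofBijective (fun p => p.2 • (Quotient.out p.1 : U)) ⟨?_, ?_⟩,
    fun ω a b => mul_smul b a _⟩
  · rintro ⟨ω, a⟩ ⟨ω', a'⟩ h
    dsimp only at h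
    have h1 : (Quotient.mk'' (Quotient.out ω : U) : MulAction.orbitRel.Quotient A U) =
        Quotient.mk'' (Quotient.out ω' : U) := by
      rw [Quotient.eq'', MulAction.orbitRel_apply]
      exact ⟨a⁻¹ * a', by dsimp only; rw [mul_smul, ← h, inv_smul_smul]⟩
    rw [Quotient.out_eq', Quotient.out_eq'] at h1
    subst h1
    have h2 : (a'⁻¹ * a) • (Quotient.out ω : U) = Quotient.out ω := by
      rw [mul_smul, h, inv_smul_smul]
    rw [inv_mul_eq_one.1 (hU _ _ h2)]
  · intro u
    have h1 : (Quotient.mk'' u : MulAction.orbitRel.Quotient A U) =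
        Quotient.mk'' (Quotient.out (Quotient.mk'' u : MulAction.orbitRel.Quotient A U)) :=
      (Quotient.out_eq' _).symm
    rw [Quotient.eq'', MulAction.orbitRel_apply] at h1
    obtain ⟨a, ha⟩ := h1
    exact ⟨(Quotient.mk'' u, a), ha⟩

/-- Finite free actions on sets of the same size are isomorphic. -/
theorem exists_equivariant_equiv {A U V : Type*} [Group A] [Finite A] [Finite U] [Finite V]
    [MulAction A U] [MulAction A V] (hU : ∀ (a : A) (u : U), a • u = u → a = 1)
    (hV : ∀ (a : A) (v : V), a • v = v → a = 1) (hcard : Nat.card U = Nat.card V) :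
    ∃ e : U ≃ V, ∀ (a : A) (u : U), e (a • u) = a • e u := by
  obtain ⟨f, hf⟩ := exists_orbit_coordinates hU
  obtain ⟨g, hg⟩ := exists_orbit_coordinates hV
  have h1 : Nat.card (MulAction.orbitRel.Quotient A U) =
      Nat.card (MulAction.orbitRel.Quotient A V) := by
    have h2 := Nat.card_congr f
    have h3 := Nat.card_congr g
    rw [Nat.card_prod] at h2 h3
    exact Nat.eq_of_mul_eq_mul_right Nat.card_pos (h2.trans (hcard.trans h3.symm))
  have hfin : Finite (MulAction.orbitRel.Quotient A U) := Quotient.finite _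
  have hfin' : Finite (MulAction.orbitRel.Quotient A V) := Quotient.finite _
  obtain ⟨c⟩ := Finite.card_eq.1 h1
  refine ⟨(f.symm.trans (c.prodCongr (Equiv.refl A))).trans g, fun a u => ?_⟩
  obtain ⟨⟨ω, b⟩, rfl⟩ := f.surjective u
  rw [← hf]
  simp [hg]

/-- A partially defined equivariant injection between two free actions of a finite group on a
finite set extends to an equivariant permutation. -/
theorem exists_equivariant_perm {A X : Type*} [Group A] [Finite A] [Finite X]
    (α β : A →* Equiv.Perm X) (hα : ∀ a x, α a x = x → a = 1) (hβ : ∀ a x, β a x = x → a = 1)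
    (S : Set X) (s : X → X) (hs : Set.InjOn s S) (hS : ∀ a, ∀ x ∈ S, α a x ∈ S)
    (he : ∀ a, ∀ x ∈ S, s (α a x) = β a (s x)) :
    ∃ τ : Equiv.Perm X, (∀ x ∈ S, τ x = s x) ∧ ∀ a, τ * α a = β a * τ := by
  classical
  have hS' : ∀ a, ∀ x ∉ S, α a x ∉ S := by
    intro a x hx h
    have := hS a⁻¹ _ h
    rw [← Equiv.Perm.mul_apply, ← map_mul, inv_mul_cancel, map_one, Equiv.Perm.one_apply] at this
    exact hx this
  have hT : ∀ a, ∀ x ∈ s '' S, β a x ∈ s '' S := by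
    rintro a _ ⟨x, hx, rfl⟩
    exact ⟨α a x, hS a x hx, he a x hx⟩
  have hT' : ∀ a, ∀ x ∉ s '' S, β a x ∉ s '' S := by
    intro a x hx h
    have := hT a⁻¹ _ h
    rw [← Equiv.Perm.mul_apply, ← map_mul, inv_mul_cancel, map_one, Equiv.Perm.one_apply] at this
    exact hx this
  let _ : MulAction A {x // x ∉ S} :=
    { smul := fun a x => ⟨α a x, hS' a x x.2⟩
      one_smul := fun x => Subtype.ext (by change α 1 x.1 = x.1; simp)
      mul_smul := fun a b x => Subtype.ext (by
        change α (a * b) x.1 = α a (α b x.1); simp) }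
  let _ : MulAction A {x // x ∉ s '' S} :=
    { smul := fun a x => ⟨β a x, hT' a x x.2⟩
      one_smul := fun x => Subtype.ext (by change β 1 x.1 = x.1; simp)
      mul_smul := fun a b x => Subtype.ext (by
        change β (a * b) x.1 = β a (β b x.1); simp) }
  have hcard : Nat.card {x // x ∉ S} = Nat.card {x // x ∉ s '' S} := by
    have h1 : S.ncard + Sᶜ.ncard = Nat.card X := Set.ncard_add_ncard_compl S
    have h2 : (s '' S).ncard + (s '' S)ᶜ.ncard = Nat.card X := Set.ncard_add_ncard_compl _
    rw [hs.ncard_image] at h2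
    have h3 : Sᶜ.ncard = (s '' S)ᶜ.ncard := by omega
    exact h3
  obtain ⟨e, hee⟩ := exists_equivariant_equiv (A := A) (U := {x // x ∉ S})
    (V := {x // x ∉ s '' S}) (fun a u h => hα a u (congrArg Subtype.val h))
    (fun a u h => hβ a u (congrArg Subtype.val h)) hcard
  let τ : X → X := fun x => if h : x ∈ S then s x else (e ⟨x, h⟩).1
  have hτ1 : ∀ x ∈ S, τ x = s x := fun x hx => dif_pos hx
  have hτ2 : ∀ x (hx : x ∉ S), τ x = (e ⟨x, hx⟩).1 := fun x hx => dif_neg hx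
  have hinj : Function.Injective τ := by
    intro x y hxy
    by_cases hx : x ∈ S <;> by_cases hy : y ∈ S
    · rw [hτ1 x hx, hτ1 y hy] at hxy
      exact hs hx hy hxy
    · rw [hτ1 x hx, hτ2 y hy] at hxy
      exact absurd ⟨x, hx, hxy⟩ (e ⟨y, hy⟩).2
    · rw [hτ2 x hx, hτ1 y hy] at hxy
      exact absurd ⟨y, hy, hxy.symm⟩ (e ⟨x, hx⟩).2
    · rw [hτ2 x hx, hτ2 y hy] at hxy
      exact congrArg Subtype.val (e.injective (Subtype.ext hxy))
  refine ⟨Equiv.ofBijective τ (Finite.injective_iff_bijective.1 hinj), hτ1, fun a => ?_⟩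
  ext x
  change τ (α a x) = β a (τ x)
  by_cases hx : x ∈ S
  · rw [hτ1 _ (hS a x hx), hτ1 x hx, he a x hx]
  · rw [hτ2 _ (hS' a x hx), hτ2 x hx]
    exact congrArg Subtype.val (hee a ⟨x, hx⟩)

end FreeActions

namespace HNNExtension

variable {G : Type*} [Group G] {A B : Subgroup G} {φ : A ≃* B}

/-- The action of an element on the identity is visible in a finite part of the group. -/
theorem exists_finite_trace (g : HNNExtension G A B φ) :
    ∃ P : Set (HNNExtension G A B φ), P.Finite ∧ 1 ∈ P ∧
      ∀ X : Set (HNNExtension G A B φ), P ⊆ X → ∀ (h1 : 1 ∈ X)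
        (ψ : HNNExtension G A B φ →* Equiv.Perm X),
        (∀ h (x : X), (ψ (of h) x).1 = of h * x.1) →
        (∀ x : X, t * x.1 ∈ X → (ψ t x).1 = t * x.1) → (ψ g ⟨1, h1⟩).1 = g := by
  induction hn : tlen g generalizing g with
  | zero =>
    obtain ⟨h, rfl⟩ := tlen_eq_zero.1 hn
    refine ⟨{1}, Set.finite_singleton _, rfl, fun X hX h1 ψ h2 h3 => ?_⟩
    rw [h2, mul_one]
  | succ n ih =>
    obtain ⟨h, e, g', rfl, hl⟩ := exists_head_of_tlen (g := g) (by omega)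
    rw [hn] at hl
    obtain ⟨P, hP, hP1, hP'⟩ := ih g' (by omega)
    refine ⟨P ∪ {g', t ^ (e : ℤ) * g'}, hP.union (Set.toFinite _), Or.inl hP1,
      fun X hX h1 ψ h2 h3 => ?_⟩
    have h4 := hP' X (Set.subset_union_left.trans hX) h1 ψ h2 h3
    have hg' : g' ∈ X := hX (by simp)
    have htg' : t ^ (e : ℤ) * g' ∈ X := hX (by simp)
    rw [map_mul, map_mul, Equiv.Perm.mul_apply, Equiv.Perm.mul_apply, h2]
    have h5 : ψ g' ⟨1, h1⟩ = ⟨g', hg'⟩ := Subtype.ext h4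
    rw [h5]
    congr 1
    rcases Int.units_eq_one_or e with rfl | rfl
    · simp only [Units.val_one, zpow_one] at htg' ⊢
      exact h3 ⟨g', hg'⟩ htg'
    · simp only [Units.val_neg, Units.val_one, zpow_neg, zpow_one, map_inv] at htg' ⊢
      have h6 : ψ t ⟨t⁻¹ * g', htg'⟩ = ⟨g', hg'⟩ := by
        refine Subtype.ext ?_
        rw [h3 _ (by simpa using hg')]
        simp
      have h7 : (ψ t)⁻¹ ⟨g', hg'⟩ = ⟨t⁻¹ * g', htg'⟩ := Equiv.Perm.inv_eq_iff_eq.2 h6.symm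
      exact congrArg Subtype.val h7

/-- HNN extensions of finite groups are residually finite. -/
theorem residuallyFinite_of_finite [Finite G] : Group.ResiduallyFinite (HNNExtension G A B φ) := by
  refine Group.residuallyFinite_of_forall_exists_finite_monoidHom fun g hg => ?_
  obtain ⟨P, hP, hP1, hP'⟩ := exists_finite_trace g
  let X : Set (HNNExtension G A B φ) := Set.image2 (fun h x => of h * x) Set.univ (P ∪ {g})
  have hXfin : X.Finite := Set.Finite.image2 _ Set.finite_univ (hP.union (Set.finite_singleton g))
  have hXG : ∀ h, ∀ x ∈ X, of h * x ∈ X := by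
    rintro h _ ⟨h', -, x, hx, rfl⟩
    exact ⟨h * h', trivial, x, hx, by simp [mul_assoc]⟩
  have hPX : P ⊆ X := fun x hx => ⟨1, trivial, x, Or.inl hx, by simp⟩
  have hfin : Finite X := hXfin
  let ρ : G →* Equiv.Perm X :=
    MonoidHom.toHomPerm
      { toFun := fun h x => ⟨of h * x.1, hXG h x.1 x.2⟩
        map_one' := by
          funext x
          exact Subtype.ext (by change of 1 * x.1 = x.1; rw [map_one, one_mul])
        map_mul' := fun h h' => by
          funext x
          exact Subtype.ext
            (by change of (h * h') * x.1 = of h * (of h' * x.1); rw [map_mul, mul_assoc]) }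
  have hρ : ∀ h (x : X), (ρ h x).1 = of h * x.1 := fun h x => rfl
  have hfree : ∀ h x, ρ h x = x → h = 1 := by
    intro h x hx
    have := congrArg Subtype.val hx
    rw [hρ, mul_eq_right, ← map_one of] at this
    exact of_injective _ this
  classical
  obtain ⟨τ, hτ1, hτ2⟩ := exists_equivariant_perm (A := A) (X := X)
    (ρ.comp A.subtype) (ρ.comp (B.subtype.comp φ.toMonoidHom))
    (fun a x h => Subtype.ext (hfree _ _ h))
    (fun a x h => by
      have h1 : ((φ a : B) : G) = 1 := hfree _ _ h
      have h2 : φ a = 1 := Subtype.ext h1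
      simpa using h2)
    {x : X | t * x.1 ∈ X}
    (fun x => if h : t * x.1 ∈ X then ⟨_, h⟩ else x)
    (by
      intro x hx y hy hxy
      rw [Set.mem_ofPred_eq] at hx hy
      simp only [dif_pos hx, dif_pos hy, Subtype.mk.injEq, mul_right_inj] at hxy
      exact Subtype.ext hxy)
    (by
      intro a x hx
      rw [Set.mem_ofPred_eq] at hx ⊢
      have h1 : t * (of (a : G) * x.1) = of (φ a : G) * (t * x.1) := by
        rw [← mul_assoc, t_mul_of, mul_assoc]
      change t * (of (a : G) * x.1) ∈ X
      rw [h1]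
      exact hXG _ _ hx)
    (by
      intro a x hx
      rw [Set.mem_ofPred_eq] at hx
      have h1 : t * (of (a : G) * x.1) = of (φ a : G) * (t * x.1) := by
        rw [← mul_assoc, t_mul_of, mul_assoc]
      have h2 : t * (of (a : G) * x.1) ∈ X := by
        rw [h1]
        exact hXG _ _ hx
      rw [dif_pos hx, dif_pos (show t * (ρ.comp A.subtype a x).1 ∈ X from h2)]
      exact Subtype.ext h1)
  have hψ : ∀ a : A, τ * ρ a = ρ (φ a : G) * τ := hτ2
  refine ⟨Equiv.Perm X, inferInstance, inferInstance, lift ρ τ hψ, fun h => ?_⟩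
  have h1 := hP' X hPX (hPX hP1) (lift ρ τ hψ) (fun h x => by rw [lift_of, hρ]) (fun x hx => by
    rw [lift_t, hτ1 x hx, dif_pos hx])
  rw [h] at h1
  exact hg h1.symm

variable {G' : Type*} [Group G'] {A' B' : Subgroup G'} {φ' : A' ≃* B'}

/-- A homomorphism of HNN extensions preserves the length of a reduced word, if its base component
maps no relevant letter into an associated subgroup. -/
theorem tlen_map_prod (π : G →* G') (F : HNNExtension G A B φ →* HNNExtension G' A' B' φ')
    (hof : ∀ g, F (of g) = of (π g)) (ht : F t = t) (w : NormalWord.ReducedWord G A B)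
    (hw : ∀ p ∈ w.toList, ∀ u, π p.2 ∈ toSubgroup A' B' u → p.2 ∈ toSubgroup A B u) :
    tlen (F (w.prod φ)) = tlen (w.prod φ) := by
  have hchain : (w.toList.map fun p => (p.1, π p.2)).IsChain
      (fun a b => a.2 ∈ toSubgroup A' B' a.1 → a.1 = b.1) := by
    rw [List.isChain_map]
    refine w.chain.imp_of_mem_imp ?_
    intro a b ha _ h h'
    exact h (hw a ha _ h')
  have := tlen_prod (φ := φ') ⟨π w.head, _, hchain⟩
  rw [tlen_prod, ← List.length_map (as := w.toList) (fun p => (p.1, π p.2)), ← this]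
  congr 1
  simp only [NormalWord.ReducedWord.prod, map_mul, hof, map_list_prod, List.map_map]
  congr 3
  funext p
  simp [hof, ht]

end HNNExtension

section ResiduallyFinite

theorem exists_finite_hom_of_finite {G : Type} [Group G] [Group.ResiduallyFinite G] {S : Set G}
    (hS : S.Finite) (h1 : 1 ∉ S) :
    ∃ (F : Type) (_ : Group F) (_ : Finite F) (f : G →* F), ∀ g ∈ S, f g ≠ 1 := by
  have hex : ∀ g : S, ∃ N : FiniteIndexNormalSubgroup G, g.1 ∉ N := fun g =>
    Group.exists_finiteIndexNormalSubgroup_notMem g.1 (fun h => h1 (h ▸ g.2))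
  choose N hN using hex
  have : Finite S := hS
  have : ∀ g : S, Finite (G ⧸ (N g).toSubgroup) := fun g => Subgroup.finite_quotient_of_finiteIndex
  refine ⟨∀ g : S, G ⧸ (N g).toSubgroup, inferInstance, inferInstance,
    MonoidHom.pi fun g => QuotientGroup.mk' _, fun g hg h => hN ⟨g, hg⟩ ?_⟩
  have := congrFun h ⟨g, hg⟩
  exact (QuotientGroup.eq_one_iff g).1 this

/-- Surjective endomorphisms of a residually finite group generated by two elements are
injective. -/
theorem BrunnerGroup.injective_of_surjective {l m k : ℤ}
    [Group.ResiduallyFinite (BrunnerGroup l m k)] {f : BrunnerGroup l m k →* BrunnerGroup l m k}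
    (hf : Function.Surjective f) : Function.Injective f := by
  rw [injective_iff_map_eq_one]
  intro g hg
  by_contra hne
  obtain ⟨F, _, _, ψ, hψ⟩ := exists_finite_hom_of_finite (Set.finite_singleton g)
    (fun h => hne h.symm)
  have : Finite (BrunnerGroup l m k →* F) :=
    Finite.of_injective (fun ψ : BrunnerGroup l m k →* F => (ψ a, ψ t))
      (fun ψ ψ' h => hom_ext (congrArg Prod.fst h) (congrArg Prod.snd h))
  obtain ⟨ψ', h'⟩ := (Finite.injective_iff_surjective (f := fun ψ : BrunnerGroup l m k →* F =>
    ψ.comp f)).1 (fun ψ ψ' h => (MonoidHom.cancel_right hf).1 h) ψ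
  refine hψ g rfl ?_
  rw [← h', MonoidHom.comp_apply, hg, map_one]

end ResiduallyFinite

namespace BaumslagSolitar

open HNNExtension

variable {l m : ℤ} [NeZero l] [NeZero m]

/-- The homomorphism onto the free product of `ℤ/m` and `ℤ`, for `|l| = |m|`. -/
noncomputable def toFreeProduct (hlm : l = m ∨ l = -m) : BaumslagSolitar l m →*
    HNNExtension (Multiplicative (ZMod m.natAbs)) ⊥ ⊥ (MulEquiv.refl _) :=
  lift (HNNExtension.of (Multiplicative.ofAdd 1)) HNNExtension.t (by
    have h1 : (Multiplicative.ofAdd (1 : ZMod m.natAbs)) ^ m = 1 := by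
      rw [← ofAdd_zsmul, zsmul_one, ← ofAdd_zero]
      congr 1
      rw [ZMod.intCast_zmod_eq_zero_iff_dvd]
      exact Int.natAbs_dvd.2 dvd_rfl
    have h2 : (Multiplicative.ofAdd (1 : ZMod m.natAbs)) ^ l = 1 := by
      rcases hlm with rfl | rfl
      · exact h1
      · rw [zpow_neg, h1, inv_one]
    rw [← map_zpow HNNExtension.of, ← map_zpow HNNExtension.of, h1, h2, map_one, one_mul, mul_one])

theorem toFreeProduct_a_zpow (hlm : l = m ∨ l = -m) (n : ℤ) :
    toFreeProduct hlm (a ^ n) = HNNExtension.of (Multiplicative.ofAdd (n : ZMod m.natAbs)) := by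
  rw [map_zpow, toFreeProduct, lift_a, ← map_zpow, ← ofAdd_zsmul, zsmul_one]

theorem tlen_toFreeProduct (hlm : l = m ∨ l = -m) (g : BaumslagSolitar l m) :
    tlen (toFreeProduct hlm g) = tlen g := by
  obtain ⟨w, rfl, -⟩ := exists_reducedWord g
  refine tlen_map_prod (AddMonoidHom.toMultiplicative (Int.castAddHom (ZMod m.natAbs)))
    (toFreeProduct hlm) (fun x => ?_) (lift_b _ _ _) w (fun p _ u hp => ?_)
  · have := toFreeProduct_a_zpow hlm x.toAdd
    rw [a_zpow] at this
    exact this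
  · have h1 : AddMonoidHom.toMultiplicative (Int.castAddHom (ZMod m.natAbs)) p.2 = 1 := by
      rcases Int.units_eq_one_or u with rfl | rfl <;> exact Subgroup.mem_bot.1 hp
    have h2 : ((p.2.toAdd : ℤ) : ZMod m.natAbs) = 0 := h1
    rw [ZMod.intCast_zmod_eq_zero_iff_dvd, Int.natAbs_dvd] at h2
    have h3 : ∀ n : ℤ, n ∣ p.2.toAdd → p.2 ∈ Subgroup.zpowers (Multiplicative.ofAdd n) := by
      rintro n ⟨c, hc⟩
      refine ⟨c, ?_⟩
      dsimp only
      rw [← ofAdd_zsmul, smul_eq_mul, mul_comm, ← hc, ofAdd_toAdd]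
    rcases Int.units_eq_one_or u with rfl | rfl
    · exact h3 m h2
    · refine h3 l ?_
      rcases hlm with rfl | rfl
      · exact h2
      · exact (neg_dvd).2 h2

theorem exists_finite_hom_ne_zpow (hlm : l = m ∨ l = -m) {g : BaumslagSolitar l m}
    (hg : tlen g ≠ 0) : ∃ (Q : Type) (_ : Group Q) (_ : Finite Q) (π : BaumslagSolitar l m →* Q),
      ∀ n : ℤ, π g ≠ π (a ^ n) := by
  have : NeZero m.natAbs := ⟨Int.natAbs_ne_zero.2 (NeZero.ne m)⟩
  have : Finite (Multiplicative (ZMod m.natAbs)) := inferInstanceAs (Finite (ZMod m.natAbs))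
  have := residuallyFinite_of_finite (G := Multiplicative (ZMod m.natAbs)) (A := ⊥) (B := ⊥)
    (φ := MulEquiv.refl _)
  obtain ⟨Q, _, _, ψ, hψ⟩ := exists_finite_hom_of_finite
    (S := Set.range fun q => toFreeProduct hlm g * (HNNExtension.of q)⁻¹) (Set.finite_range _) (by
      rintro ⟨q, hq⟩
      refine hg ?_
      rw [← tlen_toFreeProduct hlm, mul_inv_eq_one.1 hq, tlen_of])
  refine ⟨Q, inferInstance, inferInstance, ψ.comp (toFreeProduct hlm), fun n h => ?_⟩
  refine hψ _ ⟨Multiplicative.ofAdd (n : ZMod m.natAbs), rfl⟩ ?_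
  rw [MonoidHom.comp_apply, MonoidHom.comp_apply, toFreeProduct_a_zpow] at h
  rw [map_mul, map_inv, h, mul_inv_cancel]

/-- The homomorphism onto a dihedral or cyclic group, for `|l| = |m|`. -/
noncomputable def toDihedral (hlm : l = m ∨ l = -m) (N : ℕ) :
    BaumslagSolitar l m →* DihedralGroup N :=
  haveI := Classical.propDecidable
  lift (DihedralGroup.r 1) (if l = m then 1 else DihedralGroup.sr 0) (by
    split_ifs with h
    · rw [h, one_mul, mul_one]
    · rw [hlm.resolve_left h, DihedralGroup.r_one_zpow, DihedralGroup.r_one_zpow,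
        DihedralGroup.sr_mul_r, DihedralGroup.r_mul_sr]
      simp)

theorem toDihedral_a_zpow (hlm : l = m ∨ l = -m) (N : ℕ) (n : ℤ) :
    toDihedral hlm N (a ^ n) = DihedralGroup.r (n : ZMod N) := by
  rw [map_zpow, toDihedral, lift_a, DihedralGroup.r_one_zpow]

theorem toDihedral_b (hlm : l = m ∨ l = -m) (N : ℕ) :
    toDihedral hlm N b = 1 ∨ toDihedral hlm N b = DihedralGroup.sr 0 := by
  rw [toDihedral, lift_b]
  split_ifs <;> simp

theorem toDihedral_b_sq (hlm : l = m ∨ l = -m) (N : ℕ) : toDihedral hlm N b ^ 2 = 1 := by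
  rcases toDihedral_b hlm N with h | h
  · rw [h, one_pow]
  · rw [h, sq, DihedralGroup.sr_mul_self]

theorem toDihedral_a_zpow_eq_one (hlm : l = m ∨ l = -m) {N : ℕ} {n : ℤ} :
    toDihedral hlm N (a ^ n) = 1 ↔ (N : ℤ) ∣ n := by
  rw [toDihedral_a_zpow, DihedralGroup.one_def, DihedralGroup.r.injEq,
    ZMod.intCast_zmod_eq_zero_iff_dvd]

theorem dvd_of_toDihedral_a_zpow_eq (hlm : l = m ∨ l = -m) {N : ℕ} {n j : ℤ}
    (h : toDihedral hlm N (a ^ n) = toDihedral hlm N (b ^ j)) : (N : ℤ) ∣ n := by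
  rw [← toDihedral_a_zpow_eq_one hlm]
  have h2 : ∀ i : ℤ, toDihedral hlm N b ^ (2 * i) = 1 := fun i => by
    rw [zpow_mul, zpow_ofNat, toDihedral_b_sq, one_zpow]
  rw [map_zpow (toDihedral hlm N) b] at h
  obtain ⟨i, rfl | rfl⟩ := Int.even_or_odd' j
  · rw [h, h2]
  · rw [zpow_add, h2, zpow_one, one_mul] at h
    rcases toDihedral_b hlm N with h3 | h3
    · rw [h, h3]
    · rw [h3, toDihedral_a_zpow] at h
      cases h

theorem residuallyFinite (hlm : l = m ∨ l = -m) : Group.ResiduallyFinite (BaumslagSolitar l m) := by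
  refine Group.residuallyFinite_of_forall_exists_finite_monoidHom fun g hg => ?_
  by_cases h : tlen g = 0
  · obtain ⟨n, rfl⟩ := tlen_eq_zero_iff.1 h
    refine ⟨DihedralGroup (n.natAbs + 1), inferInstance, inferInstance, toDihedral hlm _, ?_⟩
    rw [Ne, toDihedral_a_zpow_eq_one]
    intro h1
    have : n = 0 := Int.eq_zero_of_abs_lt_dvd h1 (by push_cast; simp)
    exact hg (by rw [this, zpow_zero])
  · obtain ⟨Q, _, _, π, h1⟩ := exists_finite_hom_ne_zpow hlm h
    exact ⟨Q, inferInstance, inferInstance, π, by simpa using h1 0⟩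

theorem exists_finite_hom_notMem_zpowers_a (hlm : l = m ∨ l = -m) {k : ℤ} (hk : k ≠ 0)
    {g : BaumslagSolitar l m} (hg : g ∉ Subgroup.zpowers (a ^ k)) :
    ∃ (Q : Type) (_ : Group Q) (_ : Finite Q) (π : BaumslagSolitar l m →* Q),
      π g ∉ Subgroup.zpowers (π (a ^ k)) := by
  by_cases h : tlen g = 0
  · obtain ⟨n, rfl⟩ := tlen_eq_zero_iff.1 h
    have : NeZero k.natAbs := ⟨Int.natAbs_ne_zero.2 hk⟩
    refine ⟨DihedralGroup k.natAbs, inferInstance, inferInstance, toDihedral hlm _, ?_⟩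
    have h1 : toDihedral hlm k.natAbs (a ^ k) = 1 := by
      rw [toDihedral_a_zpow_eq_one, Int.natAbs_dvd]
    rw [h1, Subgroup.zpowers_one_eq_bot, Subgroup.mem_bot, toDihedral_a_zpow_eq_one, Int.natAbs_dvd]
    rintro ⟨c, rfl⟩
    exact hg ⟨c, by dsimp only; rw [zpow_mul]⟩
  · obtain ⟨Q, _, _, π, h1⟩ := exists_finite_hom_ne_zpow hlm h
    refine ⟨Q, inferInstance, inferInstance, π, ?_⟩
    rintro ⟨n, hn⟩
    refine h1 (k * n) ?_
    rw [zpow_mul, map_zpow π (a ^ k), ← hn]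

theorem exists_finite_hom_notMem_zpowers_b (hlm : l = m ∨ l = -m)
    {g : BaumslagSolitar l m} (hg : g ∉ Subgroup.zpowers b) :
    ∃ (Q : Type) (_ : Group Q) (_ : Finite Q) (π : BaumslagSolitar l m →* Q),
      π g ∉ Subgroup.zpowers (π b) := by
  have := residuallyFinite hlm
  by_cases h : Commute g b
  · obtain ⟨i, x, j, rfl, -⟩ := exists_of_commute_b_zpow one_ne_zero
      (show Commute g (b ^ (1 : ℤ)) by rwa [zpow_one])
    refine ⟨DihedralGroup (x.natAbs + 1), inferInstance, inferInstance, toDihedral hlm _, ?_⟩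
    rintro ⟨n, hn⟩
    have h1 : toDihedral hlm (x.natAbs + 1) (a ^ x) =
        toDihedral hlm (x.natAbs + 1) (b ^ (-i + n + -j)) := by
      dsimp only at hn
      rw [zpow_add, zpow_add, map_mul, map_mul, map_zpow _ b n, hn, ← map_mul, ← map_mul]
      congr 1
      group
    have : x = 0 := Int.eq_zero_of_abs_lt_dvd (dvd_of_toDihedral_a_zpow_eq hlm h1)
      (by push_cast; simp)
    exact hg ⟨i + j, by simp [this, zpow_add]⟩
  · obtain ⟨Q, _, _, π, h1⟩ := exists_finite_hom_of_finite
      (Set.finite_singleton (g * b * (b * g)⁻¹)) (fun h1 => h (mul_inv_eq_one.1 h1.symm))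
    refine ⟨Q, inferInstance, inferInstance, π, ?_⟩
    rintro ⟨n, hn⟩
    refine h1 _ rfl ?_
    have h2 : π g * π b = π b * π g := by
      rw [← hn]
      exact ((Commute.refl (π b)).zpow_left n).eq
    rw [map_mul, map_inv, map_mul, map_mul, h2, mul_inv_cancel]

/-- A finite quotient is dominated by one in which `b` and `a ^ k` have the same order. -/
theorem exists_finite_hom_orderOf_eq (hlm : l = m ∨ l = -m) {k : ℤ} (hk : k ≠ 0) {Q₀ : Type}
    [Group Q₀] [Finite Q₀] (π₀ : BaumslagSolitar l m →* Q₀) :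
    ∃ (Q : Type) (_ : Group Q) (_ : Finite Q) (π : BaumslagSolitar l m →* Q) (f : Q →* Q₀),
      f.comp π = π₀ ∧ orderOf (π b) = orderOf (π (a ^ k)) := by
  have hM : Nat.card Q₀ ≠ 0 := Nat.card_pos.ne'
  have : NeZero (2 * Nat.card Q₀) := ⟨by omega⟩
  have : NeZero (2 * Nat.card Q₀ * k.natAbs) := ⟨by simp [hk, hM]⟩
  have : Finite (Multiplicative (ZMod (2 * Nat.card Q₀))) :=
    inferInstanceAs (Finite (ZMod (2 * Nat.card Q₀)))
  let c : BaumslagSolitar l m →* Multiplicative (ZMod (2 * Nat.card Q₀)) :=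
    (AddMonoidHom.toMultiplicative (Int.castAddHom _)).comp bExp
  refine ⟨Q₀ × DihedralGroup (2 * Nat.card Q₀ * k.natAbs) × Multiplicative (ZMod (2 * Nat.card Q₀)),
    inferInstance, inferInstance, π₀.prod ((toDihedral hlm _).prod c), MonoidHom.fst _ _, rfl, ?_⟩
  have hπ : ∀ (q : Q₀) (n : ℕ), 2 * Nat.card Q₀ ∣ n → q ^ n = 1 := fun q n hn => by
    obtain ⟨d, rfl⟩ := (dvd_mul_left _ _).trans hn
    rw [pow_mul, pow_card_eq_one', one_pow]
  rw [orderOf_eq_orderOf_iff]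
  intro n
  simp only [MonoidHom.prod_apply, Prod.pow_mk, Prod.mk_eq_one]
  trans 2 * Nat.card Q₀ ∣ n
  · have hc : c b ^ n = 1 ↔ 2 * Nat.card Q₀ ∣ n := by
      rw [← ZMod.natCast_eq_zero_iff]
      have : c b ^ n = Multiplicative.ofAdd (n : ZMod (2 * Nat.card Q₀)) := by
        simp only [c, MonoidHom.comp_apply, bExp_b]
        rw [← nsmul_one, ofAdd_nsmul]
        simp
      rw [this, ofAdd_eq_one]
    rw [hc]
    refine ⟨fun h => h.2.2, fun h => ⟨hπ _ _ h, ?_, h⟩⟩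
    obtain ⟨d, rfl⟩ := (dvd_mul_right _ _).trans h
    rw [pow_mul, toDihedral_b_sq, one_pow]
  · have hc : c (a ^ k) = 1 := by
      simp only [c, MonoidHom.comp_apply, map_zpow, bExp_a, map_one, one_zpow]
    have hd : toDihedral hlm (2 * Nat.card Q₀ * k.natAbs) (a ^ k) ^ n = 1 ↔
        2 * Nat.card Q₀ ∣ n := by
      rw [← map_pow, ← zpow_natCast, ← zpow_mul, toDihedral_a_zpow_eq_one, ← Int.dvd_natAbs,
        Int.natCast_dvd_natCast, Int.natAbs_mul, Int.natAbs_natCast, mul_comm k.natAbs]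
      exact mul_dvd_mul_iff_right (Int.natAbs_ne_zero.2 hk)
    rw [hc, hd]
    exact ⟨fun h => ⟨hπ _ _ h, h, one_pow n⟩, fun h => h.2.1⟩

end BaumslagSolitar

namespace BrunnerHNN

open HNNExtension BaumslagSolitar

variable {l m k : ℤ} [NeZero l] [NeZero m] [NeZero k]

theorem exists_hom_of_orderOf_eq {Q : Type} [Group Q] (π : BaumslagSolitar l m →* Q)
    (h : orderOf (π b) = orderOf (π (a ^ k))) :
    ∃ (φ : Subgroup.zpowers (π b) ≃* Subgroup.zpowers (π (a ^ k)))
      (F : BrunnerHNN l m k →* HNNExtension Q _ _ φ),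
      (∀ g, F (of g) = HNNExtension.of (π g)) ∧ F t = HNNExtension.t := by
  have hgen : ∀ x : Q, ∀ y : Subgroup.zpowers x,
      y ∈ Subgroup.zpowers (⟨x, Subgroup.mem_zpowers x⟩ : Subgroup.zpowers x) := by
    rintro x ⟨_, n, rfl⟩
    exact ⟨n, rfl⟩
  let φ := mulEquivOfOrderOfEq (hgen (π b)) (hgen (π (a ^ k)))
    (by rw [Subgroup.orderOf_mk, Subgroup.orderOf_mk, h])
  have hφ : φ ⟨π b, Subgroup.mem_zpowers _⟩ = ⟨π (a ^ k), Subgroup.mem_zpowers _⟩ :=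
    mulEquivOfOrderOfEq_apply_gen _ _ _
  have := t_mul_of (φ := φ) ⟨π b, Subgroup.mem_zpowers _⟩
  rw [hφ] at this
  exact ⟨φ, lift (HNNExtension.of.comp π) HNNExtension.t this, lift_of _ _ _, lift_t _ _ _⟩

theorem exists_finite_hom_letters (hlm : l = m ∨ l = -m) (L : List (ℤˣ × BaumslagSolitar l m)) :
    ∃ (Q : Type) (_ : Group Q) (_ : Finite Q) (π : BaumslagSolitar l m →* Q),
      ∀ p ∈ L, (π p.2 ∈ Subgroup.zpowers (π b) → p.2 ∈ Subgroup.zpowers b) ∧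
        (π p.2 ∈ Subgroup.zpowers (π (a ^ k)) → p.2 ∈ Subgroup.zpowers (a ^ k)) := by
  have hmap : ∀ {Q₁ Q₂ : Type} [Group Q₁] [Group Q₂] (f : Q₁ →* Q₂) {x y : Q₁},
      x ∈ Subgroup.zpowers y → f x ∈ Subgroup.zpowers (f y) := by
    rintro Q₁ Q₂ _ _ f _ y ⟨n, rfl⟩
    exact ⟨n, by simp⟩
  induction L with
  | nil => exact ⟨Unit, inferInstance, inferInstance, 1, by simp⟩
  | cons p L ih =>
    obtain ⟨Q, _, _, π, hπ⟩ := ih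
    obtain ⟨Q₁, _, _, π₁, h1⟩ : ∃ (Q : Type) (_ : Group Q) (_ : Finite Q)
        (π : BaumslagSolitar l m →* Q),
        π p.2 ∈ Subgroup.zpowers (π b) → p.2 ∈ Subgroup.zpowers b := by
      by_cases h : p.2 ∈ Subgroup.zpowers b
      · exact ⟨Unit, inferInstance, inferInstance, 1, fun _ => h⟩
      · obtain ⟨Q, h1, h2, π, hπ⟩ := exists_finite_hom_notMem_zpowers_b hlm h
        exact ⟨Q, h1, h2, π, fun h => (hπ h).elim⟩
    obtain ⟨Q₂, _, _, π₂, h2⟩ : ∃ (Q : Type) (_ : Group Q) (_ : Finite Q)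
        (π : BaumslagSolitar l m →* Q),
        π p.2 ∈ Subgroup.zpowers (π (a ^ k)) → p.2 ∈ Subgroup.zpowers (a ^ k) := by
      by_cases h : p.2 ∈ Subgroup.zpowers (a ^ k)
      · exact ⟨Unit, inferInstance, inferInstance, 1, fun _ => h⟩
      · obtain ⟨Q, h1, h2, π, hπ⟩ := exists_finite_hom_notMem_zpowers_a hlm (NeZero.ne k) h
        exact ⟨Q, h1, h2, π, fun h => (hπ h).elim⟩
    refine ⟨Q × Q₁ × Q₂, inferInstance, inferInstance, π.prod (π₁.prod π₂), ?_⟩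
    intro q hq
    rcases List.mem_cons.1 hq with rfl | hq
    · exact ⟨fun h => h1 (hmap ((MonoidHom.fst Q₁ Q₂).comp (MonoidHom.snd Q (Q₁ × Q₂))) h),
        fun h => h2 (hmap ((MonoidHom.snd Q₁ Q₂).comp (MonoidHom.snd Q (Q₁ × Q₂))) h)⟩
    · exact ⟨fun h => (hπ q hq).1 (hmap (MonoidHom.fst Q (Q₁ × Q₂)) h),
        fun h => (hπ q hq).2 (hmap (MonoidHom.fst Q (Q₁ × Q₂)) h)⟩

theorem residuallyFinite (hlm : l = m ∨ l = -m) : Group.ResiduallyFinite (BrunnerHNN l m k) := by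
  have hfactor : ∀ {Q₀ : Type} [Group Q₀] [Finite Q₀] (π₀ : BaumslagSolitar l m →* Q₀),
      ∃ (K : Type) (_ : Group K) (_ : Finite K) (π : BaumslagSolitar l m →* K) (f : K →* Q₀)
        (φ : Subgroup.zpowers (π b) ≃* Subgroup.zpowers (π (a ^ k)))
        (F : BrunnerHNN l m k →* HNNExtension K _ _ φ), f.comp π = π₀ ∧
        (∀ g, F (of g) = HNNExtension.of (π g)) ∧ F t = HNNExtension.t := by
    intro Q₀ _ _ π₀
    obtain ⟨K, _, _, π, f, hf, ho⟩ := exists_finite_hom_orderOf_eq hlm (NeZero.ne k) π₀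
    obtain ⟨φ, F, hF⟩ := exists_hom_of_orderOf_eq π ho
    exact ⟨K, inferInstance, inferInstance, π, f, φ, F, hf, hF⟩
  have key : ∀ g : BrunnerHNN l m k, g ≠ 1 → ∃ (P : Type) (_ : Group P)
      (_ : Group.ResiduallyFinite P) (F : BrunnerHNN l m k →* P), F g ≠ 1 := by
    intro g hg
    by_cases h0 : tlen g = 0
    · obtain ⟨h, rfl⟩ := tlen_eq_zero.1 h0
      have := BaumslagSolitar.residuallyFinite hlm
      obtain ⟨Q₀, _, _, π₀, h1⟩ := exists_finite_hom_of_finite (Set.finite_singleton h)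
        (fun h1 => hg (by rw [← Set.mem_singleton_iff.1 h1, map_one]))
      obtain ⟨K, _, _, π, f, φ, F, hf, hF, -⟩ := hfactor π₀
      refine ⟨_, inferInstance, residuallyFinite_of_finite (φ := φ), F, fun h2 => h1 h rfl ?_⟩
      have h3 : π h = 1 := by
        refine HNNExtension.of_injective (φ := φ) ?_
        rw [map_one, ← h2]
        exact (hF h).symm
      rw [← hf, MonoidHom.comp_apply, h3, map_one]
    · obtain ⟨w, rfl, -⟩ := exists_reducedWord g
      obtain ⟨Q₀, _, _, π₀, h1⟩ := exists_finite_hom_letters (k := k) hlm w.toList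
      obtain ⟨K, _, _, π, f, φ, F, hf, hF, hF'⟩ := hfactor π₀
      have hmap : ∀ x y, π x ∈ Subgroup.zpowers (π y) → π₀ x ∈ Subgroup.zpowers (π₀ y) := by
        rintro x y ⟨n, hn⟩
        refine ⟨n, ?_⟩
        simp only [← hf, MonoidHom.comp_apply, ← hn, map_zpow]
      refine ⟨_, inferInstance, residuallyFinite_of_finite (φ := φ), F, fun h2 => h0 ?_⟩
      rw [← tlen_map_prod π F hF hF' w, h2]
      · exact tlen_eq_zero.2 ⟨1, map_one _⟩
      · intro p hp u hu
        rcases Int.units_eq_one_or u with rfl | rfl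
        · exact (h1 p hp).1 (hmap _ _ hu)
        · exact (h1 p hp).2 (hmap _ _ hu)
  refine Group.residuallyFinite_of_forall_exists_finite_monoidHom fun g hg => ?_
  obtain ⟨P, _, _, F, hF⟩ := key g hg
  obtain ⟨Q, _, _, ψ, hψ⟩ := exists_finite_hom_of_finite (Set.finite_singleton (F g))
    (fun h => hF h.symm)
  exact ⟨Q, inferInstance, inferInstance, ψ.comp F, hψ _ rfl⟩

end BrunnerHNN

namespace BrunnerGroup

theorem residuallyFinite {l m k : ℤ} (hm : m ≠ 0) (hk : k ≠ 0) (hlm : l = m ∨ l = -m) :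
    Group.ResiduallyFinite (BrunnerGroup l m k) := by
  have : NeZero m := ⟨hm⟩
  have : NeZero k := ⟨hk⟩
  have : NeZero l := ⟨by rcases hlm with rfl | rfl <;> simpa using hm⟩
  have := BrunnerHNN.residuallyFinite (k := k) hlm
  refine Group.residuallyFinite_of_forall_exists_finite_monoidHom fun g hg => ?_
  obtain ⟨Q, _, _, ψ, hψ⟩ := exists_finite_hom_of_finite
    (Set.finite_singleton (BrunnerHNN.equiv g)) (fun h => hg (by simpa using h.symm))
  exact ⟨Q, inferInstance, inferInstance, ψ.comp BrunnerHNN.equiv.toMonoidHom, hψ _ rfl⟩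

theorem lt_abs_of_mutualImagesNotIsomorphic {l₁ m₁ k₁ l₂ m₂ k₂ : ℤ} (h₁ : IsAdmissible l₁ m₁ k₁)
    (h : MutualImagesNotIsomorphic (BrunnerGroup l₁ m₁ k₁) (BrunnerGroup l₂ m₂ k₂)) :
    m₁ < |l₁| := by
  obtain ⟨hk, hm, hlm⟩ := h₁
  obtain ⟨⟨f, hf⟩, ⟨g, hg⟩, hiso⟩ := h
  refine hlm.lt_of_ne fun heq => hiso ?_
  have := residuallyFinite hm.ne' hk.ne' (eq_or_eq_neg_of_abs_eq heq.symm)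
  have h1 := injective_of_surjective (f := f.comp g) (hf.comp hg)
  exact ⟨MulEquiv.ofBijective g ⟨Function.Injective.of_comp h1, hg⟩⟩

end BrunnerGroup

theorem mainTheorem2 :
    -- the two groups are homomorphic images of each other and are not isomorphic
    MutualImagesNotIsomorphic (BrunnerGroup 18 2 2) (BrunnerGroup 18 2 6) ∧
    -- mutually homomorphic one-relator groups need not be isomorphic
    (¬ ∀ (G H : Type) [Group G] [Group H], IsOneRelatorGroup G → IsOneRelatorGroup H →
      IsHomomorphicImage G H → IsHomomorphicImage H G → Nonempty (G ≃* H)) ∧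
    -- minimality of the example among all pairs of groups `G(l,m;k)`
    (∀ l₁ m₁ k₁ l₂ m₂ k₂ : ℤ, IsAdmissible l₁ m₁ k₁ → IsAdmissible l₂ m₂ k₂ →
      MutualImagesNotIsomorphic (BrunnerGroup l₁ m₁ k₁) (BrunnerGroup l₂ m₂ k₂) →
      (2 ≤ m₁ ∧ 2 ≤ m₂) ∧
      (m₁ = 2 → 18 ≤ |l₁|) ∧ (m₂ = 2 → 18 ≤ |l₂|) ∧
      2 ≤ min k₁ k₂ ∧ 6 ≤ max k₁ k₂) := by
  obtain ⟨h₁, h₂, hiso⟩ := BrunnerGroup.mutualImagesNotIsomorphic_example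
  refine ⟨⟨h₁, h₂, hiso⟩, fun h => hiso (h _ _ ⟨_, _, ⟨MulEquiv.refl _⟩⟩ ⟨_, _, ⟨MulEquiv.refl _⟩⟩
    h₁ h₂), fun l₁ m₁ k₁ l₂ m₂ k₂ ha₁ ha₂ h => ?_⟩
  have h' : MutualImagesNotIsomorphic (BrunnerGroup l₂ m₂ k₂) (BrunnerGroup l₁ m₁ k₁) :=
    ⟨h.2.1, h.1, fun ⟨e⟩ => h.2.2 ⟨e.symm⟩⟩
  exact BrunnerGroup.lower_bounds_of_mutualImages ha₁.2.1 ha₂.2.1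
    (BrunnerGroup.lt_abs_of_mutualImagesNotIsomorphic ha₁ h)
    (BrunnerGroup.lt_abs_of_mutualImagesNotIsomorphic ha₂ h') ha₁.1 ha₂.1 h
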